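/- For $N\ge 1$ let $\mathbb{P}_N$ be the law of the $N\times N$ Gaussian orthogonal ensemble, i.e. the probability measure on the real symmetric matrices $A=(x_{ij})_{i,j=1}^N$ given by $d\mathbb{P}_N(A)=c_N\exp\bigl(-\tfrac N4\operatorname{Tr}(A^2)\bigr)\prod_{i\le j}dx_{ij}$, with normalizing constant $c_N$. Let $\mu_A=\frac1N\sum_{i=1}^N\delta_{\lambda_i}$ be the eigenvalue distribution of $A$, where $\lambda_1,\dots,\lambda_N$ are the eigenvalues of $A$ counted with multiplicity; let $\mu_W$ be the semicircle distribution, with density $\frac1{2\pi}\sqrt{4-t^2}$ on $[-2,2]$; and for a finite measure $\mu$ on $\mathbb{R}$ let $S_\mu(z)=\int_{\mathbb{R}}\frac{1}{t-z}\,d\mu(t)$ be its Stieltjes transform. Write $R_A(z)=(A-z1)^{-1}$, let $\operatorname{tr}=\frac1N\operatorname{Tr}$ be the normalized trace, and $\operatorname{Var}(X)=\mathbb{E}|X-\mathbb{E}X|^2$ for a complex random variable $X$. Let $z\in\mathbb{C}$ with $\operatorname{Im}z>0$. Then: 1. for every $N\ge1$, $\operatorname{tr}R_A(z)$ is square-integrable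 under $\mathbb{P}_N$ and $$\operatorname{Var}\bigl(\operatorname{tr}R_A(z)\bigr)\le\frac{32}{N\,(\operatorname{Im}z)^4};$$ 2. the eigenvalue distribution converges in probability to the semicircle distribution, in the sense that for every $\varepsilon>0$ $$\lim_{N\to\infty}\mathbb{P}_N\bigl\{A:\ |S_{\mu_A}(z)-S_{\mu_W}(z)|\ge\varepsilon\bigr\}=0.$$ -/

import Mathlib

open MeasureTheory Filter Topology

noncomputable section

namespace RandomMatrix

/-- The space of real symmetric `N × N` matrices. -/
abbrev SymMat (N : ℕ) : Type := {A : Matrix (Fin N) (Fin N) ℝ // A.IsSymm}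

/-- The σ-algebra generated by the matrix entries (that is, the Borel σ-algebra). -/
instance instMeasurableSpaceSymMat (N : ℕ) : MeasurableSpace (SymMat N) :=
  MeasurableSpace.comap (fun (A : SymMat N) (i j : Fin N) => A.1 i j) inferInstance

/-- Positions on and above the diagonal. -/
abbrev UpperIdx (N : ℕ) : Type := {p : Fin N × Fin N // p.1 ≤ p.2}

/-- The symmetric matrix whose entries on and above the diagonal are given by `x`. -/
def ofUpper {N : ℕ} (x : UpperIdx N → ℝ) : SymMat N :=
  ⟨Matrix.of fun i j => x ⟨(min i j, max i j), min_le_max⟩, by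
    ext i j
    simp [min_comm, max_comm]⟩

/-- The reference measure `∏_{i ≤ j} dx_{ij}` on symmetric matrices. -/
def lebesgueSym (N : ℕ) : Measure (SymMat N) :=
  (volume : Measure (UpperIdx N → ℝ)).map ofUpper

/-- The measure `exp (-(N / 4) Tr (A ^ 2)) ∏_{i ≤ j} dx_{ij}`, before normalization. -/
def goeUnnormalized (N : ℕ) : Measure (SymMat N) :=
  (lebesgueSym N).withDensity fun A =>
    ENNReal.ofReal (Real.exp (-((N : ℝ) / 4) * (A.1 ^ 2).trace))

/-- The law of the `N × N` GOE: the probability measure proportional to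
`exp (-(N / 4) Tr (A ^ 2)) ∏_{i ≤ j} dx_{ij}`. -/
def goe (N : ℕ) : Measure (SymMat N) :=
  (goeUnnormalized N Set.univ)⁻¹ • goeUnnormalized N

theorem measurable_ofUpper (N : ℕ) : Measurable (ofUpper : (UpperIdx N → ℝ) → SymMat N) := by
  refine measurable_comap_iff.2 ?_
  refine measurable_pi_lambda _ fun i => measurable_pi_lambda _ fun j => ?_
  exact measurable_pi_apply _

theorem measurable_entry {N : ℕ} (i j : Fin N) : Measurable fun A : SymMat N => A.1 i j :=
  (measurable_pi_apply j).comp ((measurable_pi_apply i).comp (comap_measurable _))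

theorem measurable_goeDensity (N : ℕ) : Measurable fun A : SymMat N =>
    ENNReal.ofReal (Real.exp (-((N : ℝ) / 4) * (A.1 ^ 2).trace)) := by
  refine ENNReal.measurable_ofReal.comp (Real.measurable_exp.comp (Measurable.const_mul ?_ _))
  simp only [pow_two, Matrix.trace, Matrix.diag, Matrix.mul_apply]
  exact Finset.measurable_sum _ fun i _ => Finset.measurable_sum _ fun j _ =>
    (measurable_entry i j).mul (measurable_entry j i)

theorem goeUnnormalized_univ (N : ℕ) : goeUnnormalized N Set.univ =
    ∫⁻ x : UpperIdx N → ℝ,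
      ENNReal.ofReal (Real.exp (-((N : ℝ) / 4) * ((ofUpper x).1 ^ 2).trace)) := by
  rw [goeUnnormalized, withDensity_apply _ MeasurableSet.univ, Measure.restrict_univ, lebesgueSym,
    lintegral_map (measurable_goeDensity N) (measurable_ofUpper N)]

theorem sum_sq_le_trace {N : ℕ} (x : UpperIdx N → ℝ) :
    ∑ p, x p ^ 2 ≤ ((ofUpper x).1 ^ 2).trace := by
  have h1 : ((ofUpper x).1 ^ 2).trace = ∑ p : Fin N × Fin N, (ofUpper x).1 p.1 p.2 ^ 2 := by
    simp only [pow_two, Matrix.trace, Matrix.diag, Matrix.mul_apply, Fintype.sum_prod_type]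
    refine Finset.sum_congr rfl fun i _ => Finset.sum_congr rfl fun j _ => ?_
    rw [(ofUpper x).2.apply i j]
  have h2 : ∀ p : UpperIdx N, x p ^ 2 = (ofUpper x).1 p.1.1 p.1.2 ^ 2 := by
    intro p
    have h3 : (⟨(min p.1.1 p.1.2, max p.1.1 p.1.2), min_le_max⟩ : UpperIdx N) = p := by
      apply Subtype.ext
      simp [min_eq_left p.2, max_eq_right p.2]
    simp only [ofUpper, Matrix.of_apply]
    rw [h3]
  rw [h1, Finset.sum_congr rfl fun p _ => h2 p]
  have h4 := Finset.sum_map (Finset.univ : Finset (UpperIdx N)) (Function.Embedding.subtype _)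
    (fun p : Fin N × Fin N => (ofUpper x).1 p.1 p.2 ^ 2)
  exact h4.symm.le.trans (Finset.sum_le_sum_of_subset_of_nonneg (Finset.subset_univ _)
    fun p _ _ => sq_nonneg _)

theorem goeUnnormalized_univ_ne_zero (N : ℕ) : goeUnnormalized N Set.univ ≠ 0 := by
  rw [goeUnnormalized_univ]
  refine (lintegral_pos_iff_support ?_).2 ?_ |>.ne'
  · exact (measurable_goeDensity N).comp (measurable_ofUpper N)
  · have : (Function.support fun x : UpperIdx N → ℝ => ENNReal.ofReal
        (Real.exp (-((N : ℝ) / 4) * ((ofUpper x).1 ^ 2).trace))) = Set.univ := by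
      ext x
      simp [Real.exp_pos]
    rw [this]
    simp [Measure.measure_univ_pos, NeZero.ne]

theorem goeUnnormalized_univ_ne_top (N : ℕ) : goeUnnormalized N Set.univ ≠ ⊤ := by
  rw [goeUnnormalized_univ]
  rcases Nat.eq_zero_or_pos N with rfl | hN
  · simp [volume_pi]
  have hN' : (0 : ℝ) < (N : ℝ) / 4 := by positivity
  have hint : Integrable fun x : UpperIdx N → ℝ =>
      ∏ p, Real.exp (-((N : ℝ) / 4) * x p ^ 2) :=
    Integrable.fintype_prod fun _ => integrable_exp_neg_mul_sq hN'
  refine ne_top_of_le_ne_top hint.lintegral_lt_top.ne (lintegral_mono fun x => ?_)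
  refine ENNReal.ofReal_le_ofReal ?_
  rw [← Real.exp_sum, ← Finset.mul_sum]
  exact Real.exp_le_exp.2 (mul_le_mul_of_nonpos_left (sum_sq_le_trace x) (by linarith))

instance instIsProbabilityMeasureGoe (N : ℕ) : IsProbabilityMeasure (goe N) :=
  ⟨by simp [goe, ENNReal.inv_mul_cancel (goeUnnormalized_univ_ne_zero N)
    (goeUnnormalized_univ_ne_top N)]⟩

theorem SymMat.isHermitian {N : ℕ} (A : SymMat N) : A.1.IsHermitian := by
  rw [Matrix.IsHermitian, Matrix.conjTranspose_eq_transpose_of_trivial]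
  exact A.2

/-- The eigenvalue distribution `μ_A = (1 / N) (δ_{λ₁} + ⋯ + δ_{λ_N})`, with the eigenvalues
counted with multiplicity. -/
def eigenvalueDistribution {N : ℕ} (A : SymMat N) : Measure ℝ :=
  (N : ENNReal)⁻¹ • ∑ i : Fin N,
    Measure.dirac ((SymMat.isHermitian A).eigenvalues i)

/-- The standard semicircle distribution, with density `√(4 - t ^ 2) / (2 π)` on `[-2, 2]`. -/
def semicircle : Measure ℝ :=
  (volume.restrict (Set.Icc (-2) 2)).withDensity fun t =>
    ENNReal.ofReal (1 / (2 * Real.pi) * Real.sqrt (4 - t ^ 2))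

/-- The Stieltjes transform `S_μ(z) = ∫ 1 / (t - z) dμ(t)`. -/
def stieltjes (μ : Measure ℝ) (z : ℂ) : ℂ :=
  ∫ t : ℝ, 1 / ((t : ℂ) - z) ∂μ

/-- The resolvent `R_A(z) = (A - z 1)⁻¹`. -/
def resolventMat {N : ℕ} (A : SymMat N) (z : ℂ) : Matrix (Fin N) (Fin N) ℂ :=
  (A.1.map (fun x : ℝ => (x : ℂ)) - z • (1 : Matrix (Fin N) (Fin N) ℂ))⁻¹

/-- The normalized trace `tr M = (1 / N) Tr M`. -/
def normTrace {N : ℕ} (M : Matrix (Fin N) (Fin N) ℂ) : ℂ :=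
  1 / (N : ℂ) * M.trace

/-- The variance `E |X - E X| ^ 2` of a complex random variable. -/
def complexVariance {Ω : Type*} [MeasurableSpace Ω] (X : Ω → ℂ) (P : Measure Ω) : ℝ :=
  ∫ ω, ‖X ω - ∫ ω', X ω' ∂P‖ ^ 2 ∂P

end RandomMatrix

end

/-! Write y = Im z. The ensemble is the image of independent centred Gaussians, of variance 2/N on
the diagonal and 1/N above it. By the resolvent identity, moving one entry by h moves tr R by at
most 2|h|/(N y²). An Efron–Stein bound over at most N² coordinates of variance at most 2/N then
gives variance at most 8/(N y⁴) for the real and the imaginary part of tr R (`variance_pi_le`,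
`norm_normTrace_resolventMat_sub_le`), within the claimed 32/(N y⁴).

For the limit, let G = E tr R. Taking traces in (A - z)R = 1 and integrating by parts against the
Gaussian weight gives 1 + zG = -E(tr R)² - E tr(R²)/N (`loop_equation`). The variance bound allows
E(tr R)² to be replaced by G² at cost O(1/N), so G nearly solves w² + zw + 1 = 0. The Stieltjes
transform of the semicircle is the root of this equation in the unit disc (`stieltjes_semicircle`).
Since Im G ≥ 0 and Im w > 0, the equation is stable and |G - w| = O(1/N)
(`norm_integral_normTrace_sub_le`). As tr R is the Stieltjes transform of the eigenvalue
distribution, Chebyshev's inequality concludes. -/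

/-! ### Variance of coordinatewise Lipschitz functions of independent variables. -/

open ProbabilityTheory in
/-- A Lipschitz function of a random variable has variance at most the squared Lipschitz constant
times the variance of the variable. -/
theorem variance_le_of_lipschitz {μ : Measure ℝ} [IsProbabilityMeasure μ]
    (hμ : MemLp id 2 μ) {f : ℝ → ℝ} (hf : Measurable f) {L : ℝ}
    (hL : ∀ s t, |f s - f t| ≤ L * |s - t|) : Var[f; μ] ≤ L ^ 2 * Var[id; μ] := by
  -- Centring at the value of f at the mean, rather than at the mean of f, costs nothing in an upper
  -- bound and lets the Lipschitz estimate apply pointwise.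
  rw [← variance_sub_const hf.aestronglyMeasurable (f (∫ x, x ∂μ))]
  refine (variance_le_expectation_sq (by fun_prop)).trans ?_
  rw [variance_eq_integral aemeasurable_id, ← integral_const_mul]
  have hi : Integrable (fun x : ℝ => (id x - ∫ x, id x ∂μ) ^ 2) μ :=
    (hμ.sub (memLp_const _)).integrable_sq
  refine integral_mono_of_nonneg (ae_of_all _ fun x => sq_nonneg _) (hi.const_mul _)
    (ae_of_all _ fun x => ?_)
  have h := hL x (∫ x, x ∂μ)
  simp only [Pi.pow_apply, id]
  rw [← sq_abs (f x - _), ← sq_abs (x - _), ← mul_pow]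
  exact pow_le_pow_left₀ (abs_nonneg _) h 2

open ProbabilityTheory in
/-- The law of total variance on a product space. -/
theorem variance_prod_eq {α β : Type*} [MeasurableSpace α] [MeasurableSpace β]
    {μ : Measure α} {ν : Measure β} [IsProbabilityMeasure μ] [IsProbabilityMeasure ν]
    {g : α × β → ℝ} (hg : Measurable g) {C : ℝ} (hC : ∀ x, |g x| ≤ C) :
    Var[g; μ.prod ν] = ∫ s, Var[fun y => g (s, y); ν] ∂μ + Var[fun s => ∫ y, g (s, y) ∂ν; μ] := by
  have hb : MemLp g 2 (μ.prod ν) := MemLp.of_bound hg.aestronglyMeasurable C (ae_of_all _ hC)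
  have hb' : ∀ s, MemLp (fun y => g (s, y)) 2 ν := fun s =>
    MemLp.of_bound (hg.comp measurable_prodMk_left).aestronglyMeasurable C
      (ae_of_all _ fun y => hC _)
  have hm : StronglyMeasurable fun s => ∫ y, g (s, y) ∂ν := hg.stronglyMeasurable.integral_prod_right'
  have hbound : ∀ s, |∫ y, g (s, y) ∂ν| ≤ C := fun s => by
    have := norm_integral_le_of_norm_le_const (μ := ν) (f := fun y => g (s, y)) (C := C)
      (ae_of_all _ fun y => hC _)
    simpa using this
  have hh : MemLp (fun s => ∫ y, g (s, y) ∂ν) 2 μ :=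
    MemLp.of_bound hm.aestronglyMeasurable C (ae_of_all _ hbound)
  have hsq := hb.integrable_sq
  rw [variance_eq_sub hb, variance_eq_sub hh]
  simp_rw [fun s => variance_eq_sub (hb' s)]
  simp only [Pi.pow_apply]
  rw [integral_sub hsq.integral_prod_left hh.integrable_sq, integral_prod _ hsq,
    integral_prod _ (hb.integrable (by norm_num))]
  ring

-- Induction on the number of coordinates through the law of total variance. Averaging over the
-- other coordinates preserves the Lipschitz constant in coordinate 0, and for each frozen value of
-- coordinate 0 the induction hypothesis bounds the conditional variance. The bound C only serves
-- integrability.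
open ProbabilityTheory in
theorem variance_pi_fin_le (n : ℕ) (μ : Fin n → Measure ℝ) [∀ i, IsProbabilityMeasure (μ i)]
    (hμ : ∀ i, MemLp id 2 (μ i)) {f : (Fin n → ℝ) → ℝ} (hf : Measurable f) {C : ℝ}
    (hC : ∀ x, |f x| ≤ C) {L : Fin n → ℝ}
    (hL : ∀ x i s t, |f (Function.update x i s) - f (Function.update x i t)| ≤ L i * |s - t|) :
    Var[f; Measure.pi μ] ≤ ∑ i, L i ^ 2 * Var[id; μ i] := by
  induction n generalizing C with
  | zero =>
    have : f = fun _ => f 0 := funext fun x => by rw [Subsingleton.elim x 0]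
    rw [this, variance_eq_integral aemeasurable_const]
    simp
  | succ n ih =>
    have mp := (measurePreserving_piFinSuccAbove μ 0).symm
    rw [← mp.variance_fun_comp hf.aemeasurable]
    set g : ℝ × (Fin n → ℝ) → ℝ :=
      fun y => f ((MeasurableEquiv.piFinSuccAbove (fun _ => ℝ) 0).symm y) with hg
    have hgv : ∀ s y, g (s, y) = f (Fin.cons s y) := fun s y => by
      simp [hg, MeasurableEquiv.piFinSuccAbove, Fin.consEquiv]
    have hgm : Measurable g := hf.comp (MeasurableEquiv.measurable _)
    rw [variance_prod_eq hgm (C := C) fun _ => hC _, Fin.sum_univ_succ, add_comm]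
    refine add_le_add ?_ ?_
    · refine variance_le_of_lipschitz (hμ 0) hgm.stronglyMeasurable.integral_prod_right'.measurable
        fun s t => ?_
      have hint : ∀ s, Integrable (fun y => g (s, y)) (Measure.pi fun j : Fin n => μ j.succ) :=
        fun s => Integrable.of_bound (hgm.comp measurable_prodMk_left).aestronglyMeasurable C
          (ae_of_all _ fun y => hC _)
      refine le_trans (le_of_eq (congrArg _ (integral_sub (hint s) (hint t)).symm)) ?_
      have := norm_integral_le_of_norm_le_const (μ := Measure.pi fun j : Fin n => μ j.succ)
        (f := fun y => g (s, y) - g (t, y)) (C := L 0 * |s - t|) (ae_of_all _ fun y => by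
          rw [hgv, hgv]
          simpa using hL (Fin.cons 0 y) 0 s t)
      simpa using this
    · refine (integral_mono_of_nonneg (ae_of_all _ fun s => variance_nonneg _ _)
        (integrable_const (∑ i : Fin n, L i.succ ^ 2 * Var[id; μ i.succ]))
        (ae_of_all _ fun s => ?_)).trans (by simp)
      refine ih (fun i => μ i.succ) (fun i => hμ _) (hgm.comp measurable_prodMk_left) (C := C)
        (fun y => hC _) (L := fun i => L i.succ) fun x i a b => ?_
      simp only [Function.comp_apply, hgv, Fin.cons_update]
      exact hL _ _ _ _

open ProbabilityTheory in
/-- Efron–Stein inequality for functions that are Lipschitz in each coordinate. -/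
theorem variance_pi_le {ι : Type*} [Fintype ι] [DecidableEq ι] (μ : ι → Measure ℝ)
    [∀ i, IsProbabilityMeasure (μ i)]
    (hμ : ∀ i, MemLp id 2 (μ i)) {f : (ι → ℝ) → ℝ} (hf : Measurable f) {C : ℝ}
    (hC : ∀ x, |f x| ≤ C) {L : ι → ℝ}
    (hL : ∀ x i s t, |f (Function.update x i s) - f (Function.update x i t)| ≤ L i * |s - t|) :
    Var[f; Measure.pi μ] ≤ ∑ i, L i ^ 2 * Var[id; μ i] := by
  let e := (Fintype.equivFin ι).symm
  have mp := measurePreserving_piCongrLeft μ e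
  rw [← mp.variance_fun_comp hf.aemeasurable, ← e.sum_comp]
  refine variance_pi_fin_le _ (fun i => μ (e i)) (fun i => hμ _)
    (hf.comp (MeasurableEquiv.measurable _)) (C := C) (fun _ => hC _)
    (L := fun i => L (e i)) fun x i s t => ?_
  have key : ∀ s, MeasurableEquiv.piCongrLeft (fun _ : ι => ℝ) e (Function.update x i s) =
      Function.update (x ∘ e.symm) (e i) s := fun s => by
    ext j
    obtain ⟨j, rfl⟩ := e.surjective j
    rw [MeasurableEquiv.piCongrLeft_apply_apply]
    by_cases h : j = i
    · subst h; simp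
    · simp [h]
  simp only [Function.comp_apply, key]
  exact hL _ _ _ _

/-! ### Spectral form, bounds, symmetry and measurability of the resolvent. -/

namespace RandomMatrix

section MatrixNorm

open scoped Matrix.Norms.L2Operator

theorem norm_apply_le_l2_opNorm {n : Type*} [Fintype n] [DecidableEq n] (M : Matrix n n ℂ)
    (i j : n) : ‖M i j‖ ≤ ‖M‖ := by
  have h := Matrix.l2_opNorm_mulVec M (EuclideanSpace.single j 1)
  have h' := PiLp.norm_apply_le (WithLp.toLp 2 (M.mulVec (EuclideanSpace.single j (1 : ℂ)).ofLp)) i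
  simp at h h'
  exact h'.trans h

theorem sub_im_ne_zero {z : ℂ} (hz : 0 < z.im) (t : ℝ) : (t : ℂ) - z ≠ 0 := by
  intro h
  have := congrArg Complex.im h
  simp at this
  exact hz.ne' this

theorem norm_one_div_sub_le {z : ℂ} (hz : 0 < z.im) (t : ℝ) : ‖1 / ((t : ℂ) - z)‖ ≤ 1 / z.im := by
  rw [norm_div, norm_one]
  refine one_div_le_one_div_of_le hz ?_
  have := Complex.abs_im_le_norm ((t : ℂ) - z)
  simpa [abs_of_pos hz] using this

/-- The complex symmetric matrix `A - z 1`. -/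
noncomputable def shifted {N : ℕ} (A : SymMat N) (z : ℂ) : Matrix (Fin N) (Fin N) ℂ :=
  A.1.map (fun x : ℝ => (x : ℂ)) - z • (1 : Matrix (Fin N) (Fin N) ℂ)

/-- The real orthogonal eigenvector matrix, read over ℂ, is unitary and diagonalises A - z and its
inverse simultaneously. The norm bound, invertibility and the trace formula all follow from this. -/
theorem exists_unitary_resolventMat {N : ℕ} (A : SymMat N) {z : ℂ} (hz : 0 < z.im) :
    ∃ U ∈ Matrix.unitaryGroup (Fin N) ℂ,
      shifted A z = U * Matrix.diagonal
        (fun i => (((SymMat.isHermitian A).eigenvalues i : ℝ) : ℂ) - z) * star U ∧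
      resolventMat A z = U * Matrix.diagonal
        (fun i => 1 / ((((SymMat.isHermitian A).eigenvalues i : ℝ) : ℂ) - z)) * star U := by
  set l := (SymMat.isHermitian A).eigenvalues
  set V : Matrix (Fin N) (Fin N) ℝ := (SymMat.isHermitian A).eigenvectorUnitary.1 with hV
  set U : Matrix (Fin N) (Fin N) ℂ := V.map Complex.ofRealHom with hU
  have hstar : star U = (star V).map Complex.ofRealHom := by
    ext i j
    simp [hU, Matrix.star_apply]
  have h1 : star U * U = 1 := by
    rw [hstar, hU, ← Matrix.map_mul, hV, Unitary.coe_star_mul_self]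
    simp
  have h2 : U * star U = 1 := mul_eq_one_comm.1 h1
  have hA : A.1 = V * Matrix.diagonal l * star V := by
    conv_lhs => rw [(SymMat.isHermitian A).spectral_theorem]
    rfl
  have hs : shifted A z = U * Matrix.diagonal (fun i => (l i : ℂ) - z) * star U := by
    have hc : A.1.map (fun x : ℝ => (x : ℂ)) =
        U * Matrix.diagonal (fun i => (l i : ℂ)) * star U := by
      have : A.1.map (fun x : ℝ => (x : ℂ)) = A.1.map Complex.ofRealHom := rfl
      rw [this, hA, Matrix.map_mul, Matrix.map_mul, hstar, Matrix.diagonal_map (by simp)]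
      rfl
    have hd : Matrix.diagonal (fun i => (l i : ℂ) - z) =
        Matrix.diagonal (fun i => (l i : ℂ)) - z • 1 := by
      rw [← Matrix.diagonal_one, ← Matrix.diagonal_smul, Matrix.diagonal_sub]
      simp
    rw [shifted, hc, hd, mul_sub, sub_mul, mul_smul_comm, mul_one, smul_mul_assoc, h2]
  refine ⟨U, Matrix.mem_unitaryGroup_iff.2 h2, hs, ?_⟩
  change (shifted A z)⁻¹ = _
  refine Matrix.inv_eq_right_inv ?_
  rw [hs]
  calc _ = U * (Matrix.diagonal (fun i => (l i : ℂ) - z) * (star U * U) *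
        Matrix.diagonal (fun i => 1 / ((l i : ℂ) - z))) * star U := by
        simp only [mul_assoc]
    _ = 1 := by
        rw [h1, mul_one, Matrix.diagonal_mul_diagonal]
        have : (fun i => ((l i : ℂ) - z) * (1 / ((l i : ℂ) - z))) = fun _ => 1 :=
          funext fun i => mul_one_div_cancel (sub_im_ne_zero hz _)
        rw [this, Matrix.diagonal_one, mul_one, h2]

theorem l2_opNorm_resolventMat_le {N : ℕ} (A : SymMat N) {z : ℂ} (hz : 0 < z.im) :
    ‖resolventMat A z‖ ≤ 1 / z.im := by
  obtain ⟨U, hU, -, h⟩ := exists_unitary_resolventMat A hz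
  rw [h]
  have e1 := CStarRing.norm_mul_mem_unitary (U * Matrix.diagonal
    (fun i => 1 / ((((SymMat.isHermitian A).eigenvalues i : ℝ) : ℂ) - z))) (Unitary.star_mem hU)
  rw [e1, CStarRing.norm_mem_unitary_mul _ hU, Matrix.l2_opNorm_diagonal,
    pi_norm_le_iff_of_nonneg (by positivity)]
  exact fun i => norm_one_div_sub_le hz _

theorem norm_resolventMat_apply_le {N : ℕ} (A : SymMat N) {z : ℂ} (hz : 0 < z.im) (i j : Fin N) :
    ‖resolventMat A z i j‖ ≤ 1 / z.im :=
  (norm_apply_le_l2_opNorm _ i j).trans (l2_opNorm_resolventMat_le A hz)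

theorem norm_resolventMat_mul_apply_le {N : ℕ} (A B : SymMat N) {z : ℂ} (hz : 0 < z.im)
    (i j : Fin N) : ‖(resolventMat A z * resolventMat B z) i j‖ ≤ 1 / z.im ^ 2 := by
  refine (norm_apply_le_l2_opNorm _ i j).trans ((Matrix.l2_opNorm_mul _ _).trans ?_)
  calc _ ≤ 1 / z.im * (1 / z.im) := by
        gcongr
        exacts [l2_opNorm_resolventMat_le A hz, l2_opNorm_resolventMat_le B hz]
    _ = _ := by ring

theorem isUnit_det_shifted {N : ℕ} (A : SymMat N) {z : ℂ} (hz : 0 < z.im) :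
    IsUnit (shifted A z).det := by
  obtain ⟨U, hU, h, -⟩ := exists_unitary_resolventMat A hz
  have h2 : U.det * (star U).det = 1 := by
    rw [← Matrix.det_mul, Matrix.mem_unitaryGroup_iff.1 hU, Matrix.det_one]
  rw [h, Matrix.det_mul, Matrix.det_mul, Matrix.det_diagonal, mul_right_comm, h2, one_mul]
  exact (Finset.prod_ne_zero_iff.2 fun i _ => sub_im_ne_zero hz _).isUnit

theorem shifted_mul_resolventMat {N : ℕ} (A : SymMat N) {z : ℂ} (hz : 0 < z.im) :
    shifted A z * resolventMat A z = 1 :=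
  Matrix.mul_nonsing_inv _ (isUnit_det_shifted A hz)

theorem resolventMat_mul_shifted {N : ℕ} (A : SymMat N) {z : ℂ} (hz : 0 < z.im) :
    resolventMat A z * shifted A z = 1 :=
  Matrix.nonsing_inv_mul _ (isUnit_det_shifted A hz)

/-- The resolvent identity. -/
theorem resolventMat_sub {N : ℕ} (A B : SymMat N) {z : ℂ} (hz : 0 < z.im) :
    resolventMat A z - resolventMat B z =
      resolventMat A z * (B.1 - A.1).map (fun x : ℝ => (x : ℂ)) * resolventMat B z := by
  have : (B.1 - A.1).map (fun x : ℝ => (x : ℂ)) = shifted B z - shifted A z := by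
    ext i j
    simp [shifted]
  rw [this, mul_sub, sub_mul, resolventMat_mul_shifted A hz, one_mul, mul_assoc,
    shifted_mul_resolventMat B hz, mul_one]

end MatrixNorm

theorem resolventMat_transpose {N : ℕ} (A : SymMat N) (z : ℂ) :
    (resolventMat A z).transpose = resolventMat A z := by
  rw [resolventMat, Matrix.transpose_nonsing_inv, Matrix.transpose_sub, Matrix.transpose_smul,
    Matrix.transpose_one, ← Matrix.transpose_map, A.2]

theorem resolventMat_symm {N : ℕ} (A : SymMat N) (z : ℂ) (i j : Fin N) :
    resolventMat A z i j = resolventMat A z j i :=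
  congrFun (congrFun (resolventMat_transpose A z).symm i) j

theorem normTrace_resolventMat {N : ℕ} (A : SymMat N) {z : ℂ} (hz : 0 < z.im) :
    normTrace (resolventMat A z) = 1 / (N : ℂ) * ∑ i,
      1 / ((((SymMat.isHermitian A).eigenvalues i : ℝ) : ℂ) - z) := by
  obtain ⟨U, hU, -, h⟩ := exists_unitary_resolventMat A hz
  rw [normTrace, h, Matrix.trace_mul_comm, ← mul_assoc, Matrix.mem_unitaryGroup_iff'.1 hU, one_mul,
    Matrix.trace_diagonal]

theorem stieltjes_eigenvalueDistribution {N : ℕ} (A : SymMat N) {z : ℂ} (hz : 0 < z.im) :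
    stieltjes (eigenvalueDistribution A) z = normTrace (resolventMat A z) := by
  rw [normTrace_resolventMat A hz, stieltjes, eigenvalueDistribution, integral_smul_measure,
    integral_finsetSum_measure fun i _ => integrable_dirac (by simp)]
  simp [integral_dirac]

theorem norm_normTrace_le {N : ℕ} {M : Matrix (Fin N) (Fin N) ℂ} {C : ℝ} (hC : 0 ≤ C)
    (h : ∀ i, ‖M i i‖ ≤ C) : ‖normTrace M‖ ≤ C := by
  rcases Nat.eq_zero_or_pos N with rfl | hN
  · simpa [normTrace] using hC
  have hN' : (0 : ℝ) < N := by exact_mod_cast hN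
  rw [normTrace, norm_mul, norm_div, norm_one, Complex.norm_natCast, one_div, inv_mul_le_iff₀ hN']
  refine (norm_sum_le _ _).trans ((Finset.sum_le_sum fun i _ => h i).trans ?_)
  simp

theorem norm_normTrace_resolventMat_le {N : ℕ} (A : SymMat N) {z : ℂ} (hz : 0 < z.im) :
    ‖normTrace (resolventMat A z)‖ ≤ 1 / z.im :=
  norm_normTrace_le (by positivity) fun i => norm_resolventMat_apply_le A hz i i

/-- Each term 1/(λ - z) has imaginary part Im z/|λ - z|². This sign later keeps G away from the
wrong root of the quadratic equation. -/
theorem im_normTrace_resolventMat_nonneg {N : ℕ} (A : SymMat N) {z : ℂ} (hz : 0 < z.im) :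
    0 ≤ (normTrace (resolventMat A z)).im := by
  rw [normTrace_resolventMat A hz]
  have : (1 / (N : ℂ)) = ((1 / (N : ℝ) : ℝ) : ℂ) := by push_cast; rfl
  rw [this, Complex.im_ofReal_mul, Complex.im_sum]
  refine mul_nonneg (by positivity) (Finset.sum_nonneg fun i _ => ?_)
  rw [one_div, Complex.inv_im]
  simp only [Complex.sub_im, Complex.ofReal_im, zero_sub, neg_neg]
  exact div_nonneg hz.le (Complex.normSq_nonneg _)

/-- By Cramer's rule the entry is a quotient of polynomials in the matrix entries. No condition on z
is needed, because both the matrix inverse and the scalar inverse take the value 0 in the singular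
case. -/
theorem measurable_resolventMat_apply {N : ℕ} (z : ℂ) (i j : Fin N) :
    Measurable fun A : SymMat N => resolventMat A z i j := by
  have h : ∀ k l, Measurable fun A : SymMat N => shifted A z k l := fun k l => by
    have : (fun A : SymMat N => shifted A z k l) =
        fun A : SymMat N => ((A.1 k l : ℝ) : ℂ) - z * (1 : Matrix (Fin N) (Fin N) ℂ) k l := by
      ext A; simp [shifted]
    rw [this]
    exact (Complex.measurable_ofReal.comp (measurable_entry k l)).sub measurable_const
  have h1 : (fun A : SymMat N => resolventMat A z i j) =
      fun A : SymMat N => ((shifted A z).det)⁻¹ * (shifted A z).adjugate i j := by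
    ext A
    change (shifted A z)⁻¹ i j = _
    rw [Matrix.inv_def, Matrix.smul_apply, Ring.inverse_eq_inv', smul_eq_mul]
  have h2 : Measurable fun A : SymMat N => (fun k l => shifted A z k l : Fin N → Fin N → ℂ) :=
    measurable_pi_lambda _ fun k => measurable_pi_lambda _ fun l => h k l
  rw [h1]
  have c1 : Continuous fun M : Fin N → Fin N → ℂ => (Matrix.of M).det :=
    Continuous.matrix_det (A := fun M : Fin N → Fin N → ℂ => Matrix.of M) continuous_id
  have c2 : Continuous fun M : Fin N → Fin N → ℂ => (Matrix.of M).adjugate i j :=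
    (Continuous.matrix_adjugate (A := fun M : Fin N → Fin N → ℂ => Matrix.of M)
      continuous_id).matrix_elem i j
  exact (c1.measurable.comp h2).inv.mul (c2.measurable.comp h2)

theorem measurable_normTrace_resolventMat {N : ℕ} (z : ℂ) :
    Measurable fun A : SymMat N => normTrace (resolventMat A z) := by
  simp only [normTrace, Matrix.trace, Matrix.diag]
  exact (Finset.measurable_sum _ fun i _ => measurable_resolventMat_apply z i i).const_mul _

end RandomMatrix

/-! ### Products of centred Gaussians and integration by parts. -/

section GaussianProduct

open ProbabilityTheory
open scoped NNReal

variable {ι : Type*} [Fintype ι]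

theorem pi_gaussianReal_eq_withDensity {v : ι → ℝ≥0} (hv : ∀ i, v i ≠ 0) :
    Measure.pi (fun i => gaussianReal 0 (v i)) = (volume : Measure (ι → ℝ)).withDensity
      fun x => ENNReal.ofReal (∏ i, gaussianPDFReal 0 (v i) (x i)) := by
  refine Measure.pi_eq fun s hs => ?_
  have hi : Integrable (fun x : ι → ℝ => ∏ i, gaussianPDFReal 0 (v i) (x i)) := by
    rw [volume_pi]
    exact Integrable.fintype_prod fun i => integrable_gaussianPDFReal 0 (v i)
  rw [withDensity_apply _ (MeasurableSet.univ_pi hs), ← ofReal_integral_eq_lintegral_ofReal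
    hi.integrableOn
    (ae_of_all _ fun x => Finset.prod_nonneg fun _ _ => gaussianPDFReal_nonneg _ _ _),
    volume_pi, Measure.restrict_pi_pi, integral_fintype_prod_eq_prod,
    ENNReal.ofReal_prod_of_nonneg fun _ _ => integral_nonneg fun _ => gaussianPDFReal_nonneg _ _ _]
  simp_rw [fun i => gaussianReal_apply_eq_integral 0 (hv i) (s i)]

theorem measurable_prod_gaussianPDFReal (v : ι → ℝ≥0) :
    Measurable fun x : ι → ℝ => ∏ i, gaussianPDFReal 0 (v i) (x i) :=
  Finset.measurable_prod _ fun i _ =>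
    (measurable_gaussianPDFReal 0 (v i)).comp (measurable_pi_apply i)

theorem prod_gaussianPDFReal_nonneg (v : ι → ℝ≥0) (x : ι → ℝ) :
    0 ≤ ∏ i, gaussianPDFReal 0 (v i) (x i) :=
  Finset.prod_nonneg fun _ _ => gaussianPDFReal_nonneg _ _ _

theorem integral_pi_gaussianReal {v : ι → ℝ≥0} (hv : ∀ i, v i ≠ 0) (f : (ι → ℝ) → ℂ) :
    ∫ x, f x ∂Measure.pi (fun i => gaussianReal 0 (v i)) =
      ∫ x, (∏ i, gaussianPDFReal 0 (v i) (x i)) • f x := by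
  rw [pi_gaussianReal_eq_withDensity hv, integral_withDensity_eq_integral_toReal_smul
    (measurable_prod_gaussianPDFReal v).ennreal_ofReal (ae_of_all _ fun x => ENNReal.ofReal_lt_top)]
  simp_rw [ENNReal.toReal_ofReal (prod_gaussianPDFReal_nonneg v _)]

theorem integrable_pi_gaussianReal_iff {v : ι → ℝ≥0} (hv : ∀ i, v i ≠ 0) (f : (ι → ℝ) → ℂ) :
    Integrable f (Measure.pi fun i => gaussianReal 0 (v i)) ↔
      Integrable fun x => (∏ i, gaussianPDFReal 0 (v i) (x i)) • f x := by
  rw [pi_gaussianReal_eq_withDensity hv, integrable_withDensity_iff_integrable_smul'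
    (measurable_prod_gaussianPDFReal v).ennreal_ofReal (ae_of_all _ fun x => ENNReal.ofReal_lt_top)]
  simp_rw [ENNReal.toReal_ofReal (prod_gaussianPDFReal_nonneg v _)]

theorem hasDerivAt_gaussianPDFReal {v : ℝ≥0} (hv : v ≠ 0) (x : ℝ) :
    HasDerivAt (gaussianPDFReal 0 v) (-(x / v) * gaussianPDFReal 0 v x) x := by
  have hv' : (v : ℝ) ≠ 0 := by exact_mod_cast hv
  have h : HasDerivAt (fun y : ℝ => -(y - 0) ^ 2 / (2 * (v : ℝ))) (-(x / v)) x := by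
    refine (((((hasDerivAt_id x).sub_const 0).pow 2).neg).div_const (2 * (v : ℝ))).congr_deriv ?_
    simp
    field_simp
  refine (h.exp.const_mul (Real.sqrt (2 * Real.pi * v))⁻¹).congr_deriv ?_
  rw [gaussianPDFReal]
  ring

theorem hasLineDerivAt_prod_gaussianPDFReal [DecidableEq ι] {v : ι → ℝ≥0} (hv : ∀ i, v i ≠ 0)
    (p : ι) (x : ι → ℝ) :
    HasLineDerivAt ℝ (fun x : ι → ℝ => ∏ i, gaussianPDFReal 0 (v i) (x i))
      (-(x p / v p) * ∏ i, gaussianPDFReal 0 (v i) (x i)) x (Pi.single p 1) := by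
  have h1 : ∀ t : ℝ, ∏ i, gaussianPDFReal 0 (v i) ((x + t • (Pi.single p 1 : ι → ℝ)) i) =
      gaussianPDFReal 0 (v p) (x p + t) *
        ∏ i ∈ Finset.univ.erase p, gaussianPDFReal 0 (v i) (x i) := fun t => by
    rw [← Finset.mul_prod_erase _ _ (Finset.mem_univ p)]
    congr 1
    · simp
    · refine Finset.prod_congr rfl fun i hi => ?_
      simp [Finset.ne_of_mem_erase hi]
  have h2 : HasDerivAt (fun t => gaussianPDFReal 0 (v p) (x p + t))
      (-(x p / v p) * gaussianPDFReal 0 (v p) (x p)) 0 := by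
    have := hasDerivAt_gaussianPDFReal (hv p) (x p + 0)
    simpa using this.comp_const_add (x p) 0
  unfold HasLineDerivAt
  simp_rw [h1]
  refine (h2.mul_const _).congr_deriv ?_
  rw [← Finset.mul_prod_erase _ _ (Finset.mem_univ p)]
  ring

/-- Gaussian integration by parts (Stein's lemma) for a product of centred Gaussian measures. -/
theorem integral_mul_pi_gaussianReal [DecidableEq ι] {v : ι → ℝ≥0} (hv : ∀ i, v i ≠ 0) (p : ι)
    {f f' : (ι → ℝ) → ℂ} (hf : Measurable f) (hf' : Measurable f') {C C' : ℝ}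
    (hC : ∀ x, ‖f x‖ ≤ C) (hC' : ∀ x, ‖f' x‖ ≤ C')
    (hd : ∀ x, HasLineDerivAt ℝ f (f' x) x (Pi.single p 1)) :
    ∫ x, (x p : ℂ) * f x ∂Measure.pi (fun i => gaussianReal 0 (v i)) =
      (v p : ℂ) * ∫ x, f' x ∂Measure.pi (fun i => gaussianReal 0 (v i)) := by
  have hv' : (v p : ℂ) ≠ 0 := by exact_mod_cast hv p
  have i1 : Integrable f (Measure.pi fun i => gaussianReal 0 (v i)) :=
    .of_bound hf.aestronglyMeasurable C (ae_of_all _ hC)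
  have i2 : Integrable f' (Measure.pi fun i => gaussianReal 0 (v i)) :=
    .of_bound hf'.aestronglyMeasurable C' (ae_of_all _ hC')
  have i3 : Integrable (fun x : ι → ℝ => (x p : ℂ)) (Measure.pi fun i => gaussianReal 0 (v i)) := by
    refine Integrable.ofReal (integrable_eval (μ := fun i => gaussianReal 0 (v i)) (i := p) ?_)
    exact (memLp_id_gaussianReal 1).integrable (by norm_num)
  have i4 : Integrable (fun x : ι → ℝ => (-((x p : ℂ) / v p)) * f x)
      (Measure.pi fun i => gaussianReal 0 (v i)) :=
    ((i3.div_const _).neg).mul_bdd (c := C) hf.aestronglyMeasurable (ae_of_all _ hC)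
  have e : ∀ x : ι → ℝ, (-(x p / v p) * ∏ i, gaussianPDFReal 0 (v i) (x i)) • f x =
      (∏ i, gaussianPDFReal 0 (v i) (x i)) • ((-((x p : ℂ) / v p)) * f x) := fun x => by
    simp only [Complex.real_smul]
    push_cast
    ring
  -- Integration by parts is done against Lebesgue measure, with the density as one factor: its
  -- derivative along coordinate p is -(x_p/v_p) times itself.
  have key := integral_bilinear_hasLineDerivAt_right_eq_neg_left_of_integrable
    (μ := (volume : Measure (ι → ℝ))) (B := ContinuousLinearMap.lsmul ℝ ℝ)
    (f := fun x : ι → ℝ => ∏ i, gaussianPDFReal 0 (v i) (x i)) (g := f) (g' := f')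
    (f' := fun x => -(x p / v p) * ∏ i, gaussianPDFReal 0 (v i) (x i)) (v := Pi.single p 1)
    (by simpa only [ContinuousLinearMap.lsmul_apply, e] using
      (integrable_pi_gaussianReal_iff hv _).1 i4)
    (by simpa using (integrable_pi_gaussianReal_iff hv _).1 i2)
    (by simpa using (integrable_pi_gaussianReal_iff hv _).1 i1)
    (fun x _ => hasLineDerivAt_prod_gaussianPDFReal hv p x) fun x _ => hd x
  simp only [ContinuousLinearMap.lsmul_apply, e] at key
  rw [← integral_pi_gaussianReal hv, ← integral_pi_gaussianReal hv] at key
  rw [key, ← integral_neg, ← integral_const_mul]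
  refine integral_congr_ae (ae_of_all _ fun x => ?_)
  simp only
  field_simp

end GaussianProduct

/-! ### The orthogonal ensemble as the law of independent Gaussian entries. -/

namespace RandomMatrix

open ProbabilityTheory
open scoped NNReal

/-- The variances of the independent entries of the Gaussian orthogonal ensemble. -/
noncomputable def entryVar (N : ℕ) (p : UpperIdx N) : ℝ≥0 :=
  if p.1.1 = p.1.2 then 2 / N else 1 / N

theorem entryVar_ne_zero {N : ℕ} (hN : 1 ≤ N) (p : UpperIdx N) : entryVar N p ≠ 0 := by
  have : (N : ℝ≥0) ≠ 0 := by exact_mod_cast (by omega : N ≠ 0)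
  unfold entryVar
  split_ifs <;> positivity

theorem entryVar_le (N : ℕ) (p : UpperIdx N) : (entryVar N p : ℝ) ≤ 2 / N := by
  unfold entryVar
  split_ifs
  · simp
  · push_cast
    gcongr
    norm_num

/-- The law of the independent entries on and above the diagonal. -/
noncomputable def entryLaw (N : ℕ) : Measure (UpperIdx N → ℝ) :=
  Measure.pi fun p => gaussianReal 0 (entryVar N p)

instance instIsProbabilityMeasureEntryLaw (N : ℕ) : IsProbabilityMeasure (entryLaw N) := by
  unfold entryLaw
  infer_instance

theorem sum_upperIdx {N : ℕ} (f : Fin N × Fin N → ℝ) :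
    ∑ p : UpperIdx N, f p.1 = ∑ i, ∑ j, if i ≤ j then f (i, j) else 0 := by
  rw [← Fintype.sum_prod_type' (f := fun i j => if i ≤ j then f (i, j) else 0),
    ← Finset.sum_filter]
  exact (Finset.sum_subtype (Finset.univ.filter fun p : Fin N × Fin N => p.1 ≤ p.2)
    (by simp) f).symm

theorem ofUpper_apply_upperIdx {N : ℕ} (x : UpperIdx N → ℝ) (p : UpperIdx N) :
    (ofUpper x).1 p.1.1 p.1.2 = x p := by
  have h : (⟨(min p.1.1 p.1.2, max p.1.1 p.1.2), min_le_max⟩ : UpperIdx N) = p := by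
    apply Subtype.ext
    simp [min_eq_left p.2, max_eq_right p.2]
  simp only [ofUpper, Matrix.of_apply]
  rw [h]

theorem trace_sq_ofUpper {N : ℕ} (x : UpperIdx N → ℝ) :
    ((ofUpper x).1 ^ 2).trace = ∑ p, (if p.1.1 = p.1.2 then 1 else 2) * x p ^ 2 := by
  have h1 : ((ofUpper x).1 ^ 2).trace = ∑ i, ∑ j, (ofUpper x).1 i j ^ 2 := by
    simp only [pow_two, Matrix.trace, Matrix.diag, Matrix.mul_apply]
    refine Finset.sum_congr rfl fun i _ => Finset.sum_congr rfl fun j _ => ?_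
    rw [(ofUpper x).2.apply i j]
  have h2 := sum_upperIdx (N := N)
    fun p => (if p.1 = p.2 then 1 else 2) * (ofUpper x).1 p.1 p.2 ^ 2
  simp only [ofUpper_apply_upperIdx] at h2
  rw [h2, h1]
  have h3 : ∑ i, ∑ j, (ofUpper x).1 i j ^ 2 =
      ∑ i, ∑ j, (if i ≤ j then (ofUpper x).1 i j ^ 2 else 0) +
        ∑ i, ∑ j, (if i < j then (ofUpper x).1 i j ^ 2 else 0) := by
    rw [Finset.sum_comm (f := fun i j => if i < j then (ofUpper x).1 i j ^ 2 else 0)]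
    simp only [← Finset.sum_add_distrib]
    refine Finset.sum_congr rfl fun i _ => Finset.sum_congr rfl fun j _ => ?_
    rw [(ofUpper x).2.apply i j]
    rcases le_or_gt i j with h | h
    · simp [h]
    · simp [h]
  rw [h3]
  simp only [← Finset.sum_add_distrib]
  refine Finset.sum_congr rfl fun i _ => Finset.sum_congr rfl fun j _ => ?_
  rcases lt_trichotomy i j with h | h | h
  · simp [h, h.le, h.ne]; ring
  · simp [h]
  · simp [h.not_ge, h.not_gt]

/-- In Tr A² a diagonal entry occurs once and an off-diagonal one twice, so the exponents are -N
x²/4 and -N x²/2; these are the Gaussian exponents for variances 2/N and 1/N. -/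
theorem prod_gaussianPDFReal_entryVar {N : ℕ} (hN : 1 ≤ N) (x : UpperIdx N → ℝ) :
    ∏ p, gaussianPDFReal 0 (entryVar N p) (x p) =
      (∏ p, (Real.sqrt (2 * Real.pi * entryVar N p))⁻¹) *
        Real.exp (-((N : ℝ) / 4) * ((ofUpper x).1 ^ 2).trace) := by
  have hN' : (N : ℝ) ≠ 0 := by exact_mod_cast (by omega : N ≠ 0)
  simp only [gaussianPDFReal]
  rw [Finset.prod_mul_distrib, ← Real.exp_sum, trace_sq_ofUpper, Finset.mul_sum]
  congr 2
  refine Finset.sum_congr rfl fun p _ => ?_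
  unfold entryVar
  split_ifs
  · push_cast
    field_simp
    ring
  · push_cast
    field_simp
    ring

/-- Both sides are multiples of the same unnormalised measure and the right side has mass 1, so the
constants agree without the normalisation integral being computed. -/
theorem goe_eq_map {N : ℕ} (hN : 1 ≤ N) : goe N = (entryLaw N).map ofUpper := by
  set c := ∏ p, (Real.sqrt (2 * Real.pi * entryVar N p))⁻¹ with hc
  have hc0 : 0 < c := Finset.prod_pos fun p _ => by
    have : (0 : ℝ) < entryVar N p := by exact_mod_cast pos_iff_ne_zero.2 (entryVar_ne_zero hN p)
    positivity
  have h : (entryLaw N).map ofUpper = ENNReal.ofReal c • goeUnnormalized N := by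
    ext s hs
    rw [Measure.map_apply (measurable_ofUpper N) hs, entryLaw,
      pi_gaussianReal_eq_withDensity (entryVar_ne_zero hN),
      withDensity_apply _ (measurable_ofUpper N hs), Measure.smul_apply, goeUnnormalized,
      withDensity_apply _ hs, lebesgueSym, setLIntegral_map hs (measurable_goeDensity N)
        (measurable_ofUpper N), smul_eq_mul, ← lintegral_const_mul' _ _
        ENNReal.ofReal_ne_top]
    refine lintegral_congr fun x => ?_
    rw [prod_gaussianPDFReal_entryVar hN, ENNReal.ofReal_mul hc0.le]
  have h1 : ENNReal.ofReal c * goeUnnormalized N Set.univ = 1 := by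
    have : ((entryLaw N).map ofUpper) Set.univ = 1 := by
      rw [Measure.map_apply (measurable_ofUpper N) MeasurableSet.univ]
      simp
    rwa [h] at this
  rw [h, goe, ENNReal.eq_inv_of_mul_eq_one_left h1]

/-! ### The Stieltjes transform of the semicircle distribution. -/

/-- The two roots have product 1, and a root of modulus 1 would make z = -(w + 1/w) real, so exactly
one root lies in the disc. Taking imaginary parts, Im z · |w|² = Im w · (1 - |w|²), which gives the
sign of Im w. -/
theorem exists_root_semicircle {z : ℂ} (hz : 0 < z.im) :
    ∃ w : ℂ, w ^ 2 + z * w + 1 = 0 ∧ ‖w‖ < 1 ∧ 0 < w.im := by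
  obtain ⟨s, hs⟩ := IsAlgClosed.exists_pow_nat_eq (z ^ 2 - 4) (n := 2) (by norm_num)
  have key : ∀ w : ℂ, w ^ 2 + z * w + 1 = 0 → ‖w‖ < 1 → 0 < w.im := fun w hw h1 => by
    have hw0 : w ≠ 0 := by rintro rfl; simp at hw
    have hz' : z = -(w + w⁻¹) := by field_simp; linear_combination hw
    have h2 : z.im * Complex.normSq w = w.im * (1 - Complex.normSq w) := by
      have h0 : Complex.normSq w ≠ 0 := by simpa using hw0
      rw [hz']
      simp only [Complex.neg_im, Complex.add_im, Complex.inv_im]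
      field_simp
      ring
    have h3 : 0 < Complex.normSq w := Complex.normSq_pos.2 hw0
    have h4 : Complex.normSq w < 1 := by
      rw [Complex.normSq_eq_norm_sq]; nlinarith [norm_nonneg w]
    have h5 : 0 < z.im * Complex.normSq w := mul_pos hz h3
    rw [h2] at h5
    exact pos_of_mul_pos_left h5 (by linarith)
  have hne : ∀ w : ℂ, w ^ 2 + z * w + 1 = 0 → ‖w‖ ≠ 1 := fun w hw h1 => by
    have hw0 : w ≠ 0 := by rintro rfl; simp at hw
    have hz' : z = -(w + w⁻¹) := by field_simp; linear_combination hw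
    have h0 : Complex.normSq w = 1 := by rw [Complex.normSq_eq_norm_sq, h1]; norm_num
    have : z.im = 0 := by
      rw [hz']
      simp [Complex.inv_im, h0]
    exact hz.ne' this
  set a := (-z + s) / 2 with ha
  set b := (-z - s) / 2 with hb
  have h1 : a ^ 2 + z * a + 1 = 0 := by rw [ha]; linear_combination hs / 4
  have h2 : b ^ 2 + z * b + 1 = 0 := by rw [hb]; linear_combination hs / 4
  have hab : a * b = 1 := by rw [ha, hb]; linear_combination -hs / 4
  rcases lt_or_gt_of_ne (hne a h1) with h | h
  · exact ⟨a, h1, h, key a h1 h⟩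
  · have hb1 : ‖b‖ < 1 := by
      have : ‖a‖ * ‖b‖ = 1 := by rw [← norm_mul, hab, norm_one]
      nlinarith [norm_nonneg b]
    exact ⟨b, h2, hb1, key b h2 hb1⟩

theorem one_add_mul_ne_zero {w a : ℂ} (hw : ‖w‖ < 1) (ha : ‖a‖ ≤ 1) : 1 + w * a ≠ 0 := by
  intro h
  have : w * a = -1 := by linear_combination h
  have h2 : ‖w‖ * ‖a‖ = 1 := by rw [← norm_mul, this, norm_neg, norm_one]
  nlinarith [norm_nonneg w, norm_nonneg a]

/-- Mean value property on the unit circle: w(1 - a²)/(1 + wa) is holomorphic near the closed disc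
because |w| < 1, and equals w at a = 0. -/
theorem integral_semicircle_aux {w : ℂ} (hw : ‖w‖ < 1) :
    ∫ θ in (-Real.pi)..Real.pi, w * (1 - circleMap 0 1 θ ^ 2) / (1 + w * circleMap 0 1 θ) =
      2 * Real.pi * w := by
  have hd : DiffContOnCl ℂ (fun a : ℂ => w * (1 - a ^ 2) / (1 + w * a))
      (Metric.ball 0 |(1 : ℝ)|) := by
    rw [abs_one]
    refine DifferentiableOn.diffContOnCl fun a ha => ?_
    rw [closure_ball _ one_ne_zero] at ha
    have : 1 + w * a ≠ 0 := one_add_mul_ne_zero hw (by simpa using ha)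
    have h1 : DifferentiableAt ℂ (fun a : ℂ => w * (1 - a ^ 2)) a := by fun_prop
    have h2 : DifferentiableAt ℂ (fun a : ℂ => 1 + w * a) a := by fun_prop
    exact (h1.div h2 this).differentiableWithinAt
  have h := hd.circleAverage
  rw [Real.circleAverage_def] at h
  have hp : Function.Periodic (fun θ : ℝ => w * (1 - circleMap 0 1 θ ^ 2) /
      (1 + w * circleMap 0 1 θ)) (2 * Real.pi) := fun θ => by
    simp only [periodic_circleMap 0 1 θ]
  have e := hp.intervalIntegral_add_eq (-Real.pi) 0
  rw [zero_add, show -Real.pi + 2 * Real.pi = Real.pi by ring] at e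
  rw [e]
  simp only [ne_eq, OfNat.ofNat_ne_zero, not_false_eq_true, zero_pow, sub_zero, mul_one, mul_zero,
    add_zero, div_one] at h
  have hpi : (2 * Real.pi : ℝ) ≠ 0 := by positivity
  rw [inv_smul_eq_iff₀ hpi, Complex.real_smul] at h
  rw [h]
  push_cast
  ring

/-- Partial fractions: with a = exp(iθ) and b = 1/a, the quadratic equation gives the factorisation
w(2 cos θ - z) = (1 + wa)(1 + wb). -/
theorem integrand_semicircle_eq {z w : ℂ} (hz : 0 < z.im) (hw : w ^ 2 + z * w + 1 = 0)
    (hw1 : ‖w‖ < 1) (θ : ℝ) :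
    (4 * Real.sin θ ^ 2 : ℂ) / (2 * Real.cos θ - z) =
      w * (1 - circleMap 0 1 θ ^ 2) / (1 + w * circleMap 0 1 θ) +
        w * (1 - circleMap 0 1 (-θ) ^ 2) / (1 + w * circleMap 0 1 (-θ)) := by
  set a := circleMap 0 1 θ with ha
  set b := circleMap 0 1 (-θ) with hb
  have ha' : a = Real.cos θ + Real.sin θ * Complex.I := by
    rw [ha, circleMap, Complex.exp_mul_I]; simp
  have hb' : b = Real.cos θ - Real.sin θ * Complex.I := by
    rw [hb, circleMap, Complex.exp_mul_I]; simp; ring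
  have hna : ‖a‖ ≤ 1 := by simp [ha]
  have hnb : ‖b‖ ≤ 1 := by simp [hb]
  have h1 := one_add_mul_ne_zero hw1 hna
  have h2 := one_add_mul_ne_zero hw1 hnb
  have hcs : (Real.cos θ : ℂ) ^ 2 + (Real.sin θ : ℂ) ^ 2 = 1 := by
    exact_mod_cast Real.cos_sq_add_sin_sq θ
  have hab : a * b = 1 := by
    rw [ha', hb']
    linear_combination hcs - (Real.sin θ : ℂ) ^ 2 * Complex.I_sq
  have h3 : (2 * Real.cos θ - z : ℂ) ≠ 0 := by
    intro h
    have := congrArg Complex.im h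
    simp at this
    exact hz.ne' this
  have hc : (2 * Real.cos θ : ℂ) = a + b := by rw [ha', hb']; ring
  have hs : (4 * Real.sin θ ^ 2 : ℂ) = 4 - (a + b) ^ 2 := by
    rw [← hc]; linear_combination 4 * hcs
  have hw0 : w ≠ 0 := by rintro rfl; simp at hw
  have hz' : w * (2 * Real.cos θ - z) = (1 + w * a) * (1 + w * b) := by
    rw [hc]; linear_combination -hw - w ^ 2 * hab
  rw [div_add_div _ _ h1 h2, ← hz', div_eq_div_iff h3 (mul_ne_zero hw0 h3), hs]
  have : (4 - (a + b) ^ 2) * w = w * (1 - a ^ 2) * (1 + w * b) + (1 + w * a) * (w * (1 - b ^ 2)) := by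
    linear_combination w * (-2 + w * (a + b)) * hab
  rw [← this]
  ring

theorem stieltjes_semicircle {z w : ℂ} (hz : 0 < z.im) (hw : w ^ 2 + z * w + 1 = 0)
    (hw1 : ‖w‖ < 1) : stieltjes semicircle z = w := by
  have hne : ∀ t : ℝ, (t : ℂ) - z ≠ 0 := fun t h => by
    have := congrArg Complex.im h
    simp at this
    exact hz.ne' this
  set G : ℝ → ℂ := fun t => (Real.sqrt (4 - t ^ 2) : ℂ) * (1 / ((t : ℂ) - z)) with hG
  have hGc : Continuous G := by
    refine (Complex.continuous_ofReal.comp (by fun_prop)).mul ?_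
    exact Continuous.div (by fun_prop) (by fun_prop) hne
  have h1 : stieltjes semicircle z = (1 / (2 * Real.pi) : ℂ) * ∫ t in (-2 : ℝ)..2, G t := by
    rw [stieltjes, semicircle, integral_withDensity_eq_integral_toReal_smul (by fun_prop)
      (ae_of_all _ fun x => ENNReal.ofReal_lt_top), intervalIntegral.integral_of_le (by norm_num),
      ← integral_Icc_eq_integral_Ioc, ← integral_const_mul]
    refine integral_congr_ae (ae_of_all _ fun t => ?_)
    simp only [hG]
    rw [ENNReal.toReal_ofReal (by positivity), Complex.real_smul]
    push_cast
    ring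
  -- The substitution t = 2 cos θ turns √(4 - t²) dt into 4 sin²θ dθ on [0, π]; the terms F(θ) and
  -- F(-θ) then assemble into one integral over the whole circle.
  have h2 := intervalIntegral.integral_deriv_smul_comp (a := 0) (b := Real.pi)
    (f := fun θ => 2 * Real.cos θ) (f' := fun θ => 2 * (-Real.sin θ)) (g := G)
    (fun θ _ => (Real.hasDerivAt_cos θ).const_mul 2) (by fun_prop) hGc
  simp only [Real.cos_zero, Real.cos_pi, mul_one, Function.comp_apply] at h2
  rw [show (2 : ℝ) * -1 = -2 by norm_num] at h2
  set F : ℝ → ℂ := fun θ => w * (1 - circleMap 0 1 θ ^ 2) / (1 + w * circleMap 0 1 θ) with hF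
  have hFc : Continuous F := by
    refine Continuous.div (by fun_prop) (by fun_prop) fun θ => one_add_mul_ne_zero hw1 (by simp)
  have h3 : ∫ t in (-2 : ℝ)..2, G t = ∫ θ in (0 : ℝ)..Real.pi, (F θ + F (-θ)) := by
    rw [intervalIntegral.integral_symm, ← h2, ← intervalIntegral.integral_neg]
    refine intervalIntegral.integral_congr fun θ hθ => ?_
    rw [Set.uIcc_of_le Real.pi_pos.le] at hθ
    have hs : 0 ≤ Real.sin θ := Real.sin_nonneg_of_mem_Icc hθ
    have hsq : Real.sqrt (4 - (2 * Real.cos θ) ^ 2) = 2 * Real.sin θ := by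
      rw [show 4 - (2 * Real.cos θ) ^ 2 = (2 * Real.sin θ) ^ 2 by
        nlinarith [Real.sin_sq_add_cos_sq θ]]
      exact Real.sqrt_sq (by positivity)
    simp only [hF, hG]
    rw [← integrand_semicircle_eq hz hw hw1, hsq, Complex.real_smul]
    push_cast
    ring
  rw [h1, h3, intervalIntegral.integral_add (hFc.intervalIntegrable _ _)
    (Continuous.intervalIntegrable (u := fun θ => F (-θ)) (by fun_prop) _ _),
    intervalIntegral.integral_comp_neg (fun θ => F θ), neg_zero, add_comm,
    intervalIntegral.integral_add_adjacent_intervals (hFc.intervalIntegrable _ _)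
      (hFc.intervalIntegrable _ _), hF, integral_semicircle_aux hw1]
  have : (Real.pi : ℂ) ≠ 0 := by exact_mod_cast Real.pi_ne_zero
  field_simp

/-! ### Perturbing one entry, and the variance bound. -/

/-- The weight of the elementary symmetric matrix at position `p`. -/
noncomputable def entryWeight {N : ℕ} (p : UpperIdx N) : ℝ := if p.1.1 = p.1.2 then 1 / 2 else 1

theorem entryWeight_nonneg {N : ℕ} (p : UpperIdx N) : 0 ≤ entryWeight p := by
  unfold entryWeight
  split_ifs <;> norm_num

theorem entryWeight_le_one {N : ℕ} (p : UpperIdx N) : entryWeight p ≤ 1 := by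
  unfold entryWeight
  split_ifs <;> norm_num

/-- The doubled variance on the diagonal cancels the weight 1/2, so integration by parts has the
same coefficient 1/N at every position. -/
theorem entryVar_mul_entryWeight {N : ℕ} (p : UpperIdx N) :
    (entryVar N p : ℝ) * entryWeight p = 1 / N := by
  unfold entryVar entryWeight
  split_ifs
  · push_cast; ring
  · simp

theorem ofUpper_single {N : ℕ} (p : UpperIdx N) (k l : Fin N) :
    (ofUpper (Pi.single p 1)).1 k l = entryWeight p *
      ((if k = p.1.1 ∧ l = p.1.2 then 1 else 0) + (if k = p.1.2 ∧ l = p.1.1 then 1 else 0)) := by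
  obtain ⟨⟨a, b⟩, hab⟩ := p
  simp only at hab
  simp only [ofUpper, Matrix.of_apply, Pi.single_apply, Subtype.mk.injEq, Prod.mk.injEq,
    entryWeight]
  rcases le_total k l with h | h
  · rw [min_eq_left h, max_eq_right h]
    split_ifs <;> first | (norm_num; done) | (exfalso; grind)
  · rw [min_eq_right h, max_eq_left h]
    split_ifs <;> first | (norm_num; done) | (exfalso; grind)

/-- The effect on the resolvent of changing one independent entry. -/
theorem resolventMat_add_smul_single_sub {N : ℕ} {z : ℂ} (hz : 0 < z.im) (x : UpperIdx N → ℝ)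
    (p : UpperIdx N) (t : ℝ) (k l : Fin N) :
    resolventMat (ofUpper (x + t • (Pi.single p 1 : UpperIdx N → ℝ))) z k l -
        resolventMat (ofUpper x) z k l =
      -(t * entryWeight p : ℂ) *
        (resolventMat (ofUpper (x + t • (Pi.single p 1 : UpperIdx N → ℝ))) z k p.1.1 *
            resolventMat (ofUpper x) z p.1.2 l +
          resolventMat (ofUpper (x + t • (Pi.single p 1 : UpperIdx N → ℝ))) z k p.1.2 *
            resolventMat (ofUpper x) z p.1.1 l) := by
  rw [← Matrix.sub_apply, resolventMat_sub _ _ hz]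
  have h : ((ofUpper x).1 - (ofUpper (x + t • (Pi.single p 1 : UpperIdx N → ℝ))).1).map
      (fun x : ℝ => (x : ℂ)) = -(t * entryWeight p : ℂ) •
        (Matrix.single p.1.1 p.1.2 1 + Matrix.single p.1.2 p.1.1 1) := by
    ext i j
    have e : ((ofUpper x).1 - (ofUpper (x + t • (Pi.single p 1 : UpperIdx N → ℝ))).1) i j =
        -(t * (ofUpper (Pi.single p 1)).1 i j) := by
      simp [ofUpper]
    rw [Matrix.map_apply, e, ofUpper_single]
    simp only [Matrix.smul_apply, Matrix.add_apply, Matrix.single_apply, smul_eq_mul,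
      eq_comm (a := i), eq_comm (a := j), Complex.ofReal_neg, Complex.ofReal_mul,
      Complex.ofReal_add, apply_ite Complex.ofReal, Complex.ofReal_one, Complex.ofReal_zero]
    ring
  rw [h, mul_smul_comm, smul_mul_assoc, Matrix.smul_apply, mul_add, add_mul, Matrix.add_apply,
    smul_eq_mul]
  congr 2
  · simp [Matrix.mul_apply, Matrix.single_apply, ite_and]
  · simp [Matrix.mul_apply, Matrix.single_apply, ite_and]

theorem norm_normTrace_resolventMat_sub_le {N : ℕ} (hN : 1 ≤ N) {z : ℂ} (hz : 0 < z.im)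
    (x : UpperIdx N → ℝ) (p : UpperIdx N) (s t : ℝ) :
    ‖normTrace (resolventMat (ofUpper (Function.update x p s)) z) -
        normTrace (resolventMat (ofUpper (Function.update x p t)) z)‖ ≤
      2 / (N * z.im ^ 2) * |s - t| := by
  have hN' : (0 : ℝ) < N := by exact_mod_cast hN
  set y := Function.update x p t with hy
  have hu : Function.update x p s = y + (s - t) • (Pi.single p 1 : UpperIdx N → ℝ) := by
    ext q
    by_cases h : q = p
    · subst h; simp [hy]
    · simp [hy, h]
  rw [hu, normTrace, normTrace, ← mul_sub, Matrix.trace, Matrix.trace, ← Finset.sum_sub_distrib]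
  simp only [Matrix.diag, resolventMat_add_smul_single_sub hz]
  set R := resolventMat (ofUpper (y + (s - t) • (Pi.single p 1 : UpperIdx N → ℝ))) z with hR
  set Q := resolventMat (ofUpper y) z with hQ
  -- Summing over the diagonal collapses to two entries of the product Q R, each at most 1/(Im z)²
  -- by the operator norm. Hence the trace changes by O(1) and the normalised trace by O(1/N).
  have e : ∑ i, -(((s - t : ℝ) : ℂ) * entryWeight p) *
      (R i p.1.1 * Q p.1.2 i + R i p.1.2 * Q p.1.1 i) =
      -(((s - t : ℝ) : ℂ) * entryWeight p) *
        ((Q * R) p.1.2 p.1.1 + (Q * R) p.1.1 p.1.2) := by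
    rw [Matrix.mul_apply, Matrix.mul_apply, ← Finset.sum_add_distrib, Finset.mul_sum]
    exact Finset.sum_congr rfl fun i _ => by ring
  rw [e, norm_mul, norm_mul, norm_neg, norm_mul, norm_div, norm_one, Complex.norm_natCast,
    Complex.norm_real, Complex.norm_real, Real.norm_eq_abs, Real.norm_eq_abs,
    abs_of_nonneg (entryWeight_nonneg p)]
  have h1 := norm_resolventMat_mul_apply_le (ofUpper y)
    (ofUpper (y + (s - t) • (Pi.single p 1 : UpperIdx N → ℝ))) hz p.1.2 p.1.1
  have h2 := norm_resolventMat_mul_apply_le (ofUpper y)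
    (ofUpper (y + (s - t) • (Pi.single p 1 : UpperIdx N → ℝ))) hz p.1.1 p.1.2
  calc _ ≤ 1 / N * (|s - t| * 1 * (1 / z.im ^ 2 + 1 / z.im ^ 2)) := by
        gcongr
        · exact entryWeight_le_one p
        · exact (norm_add_le _ _).trans (add_le_add h1 h2)
    _ = _ := by field_simp; ring

/-- Reduces to the real-valued functions covered by the Efron–Stein bound. -/
theorem complexVariance_eq_add {Ω : Type*} [MeasurableSpace Ω] {P : Measure Ω}
    [IsProbabilityMeasure P] {X : Ω → ℂ} (hX : Measurable X) {C : ℝ} (hC : ∀ ω, ‖X ω‖ ≤ C) :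
    complexVariance X P = Var[fun ω => (X ω).re; P] + Var[fun ω => (X ω).im; P] := by
  have hi : Integrable X P := .of_bound hX.aestronglyMeasurable C (ae_of_all _ hC)
  have hre : MemLp (fun ω => (X ω).re) 2 P :=
    .of_bound (Complex.measurable_re.comp hX).aestronglyMeasurable C
      (ae_of_all _ fun ω => (Complex.abs_re_le_norm _).trans (hC ω))
  have him : MemLp (fun ω => (X ω).im) 2 P :=
    .of_bound (Complex.measurable_im.comp hX).aestronglyMeasurable C
      (ae_of_all _ fun ω => (Complex.abs_im_le_norm _).trans (hC ω))
  have er : (∫ ω, X ω ∂P).re = ∫ ω, (X ω).re ∂P := (integral_re hi).symm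
  have ei : (∫ ω, X ω ∂P).im = ∫ ω, (X ω).im ∂P := (integral_im hi).symm
  rw [variance_eq_integral hre.aestronglyMeasurable.aemeasurable,
    variance_eq_integral him.aestronglyMeasurable.aemeasurable,
    complexVariance]
  refine Eq.trans ?_ (integral_add (hre.sub (memLp_const (∫ ω, (X ω).re ∂P))).integrable_sq
    (him.sub (memLp_const (∫ ω, (X ω).im ∂P))).integrable_sq)
  refine integral_congr_ae (ae_of_all _ fun ω => ?_)
  simp only
  rw [Complex.sq_norm, Complex.normSq_apply, Complex.sub_re, Complex.sub_im, er, ei]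
  ring

theorem variance_entryLaw_le {N : ℕ} (hN : 1 ≤ N) {z : ℂ} (hz : 0 < z.im)
    {f : (UpperIdx N → ℝ) → ℝ} (hf : Measurable f) {C : ℝ} (hC : ∀ x, |f x| ≤ C)
    (hL : ∀ x p s t, |f (Function.update x p s) - f (Function.update x p t)| ≤
      2 / (N * z.im ^ 2) * |s - t|) :
    Var[f; entryLaw N] ≤ 8 / (N * z.im ^ 4) := by
  have hN' : (0 : ℝ) < N := by exact_mod_cast hN
  refine (variance_pi_le (fun p => gaussianReal 0 (entryVar N p))
    (fun p => memLp_id_gaussianReal 2) hf hC (L := fun _ => 2 / (N * z.im ^ 2)) hL).trans ?_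
  simp only [variance_id_gaussianReal]
  calc _ ≤ ∑ p : UpperIdx N, (2 / (N * z.im ^ 2)) ^ 2 * (2 / N) := by
        gcongr with p
        exact entryVar_le N p
    _ = (Fintype.card (UpperIdx N) : ℝ) * ((2 / (N * z.im ^ 2)) ^ 2 * (2 / N)) := by simp
    -- Counting the positions crudely by N² suffices.
    _ ≤ (N * N : ℝ) * ((2 / (N * z.im ^ 2)) ^ 2 * (2 / N)) := by
        gcongr
        have := Fintype.card_subtype_le fun p : Fin N × Fin N => p.1 ≤ p.2
        rw [Fintype.card_prod, Fintype.card_fin] at this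
        exact_mod_cast this
    _ = _ := by field_simp; ring

theorem complexVariance_normTrace_resolventMat_le {N : ℕ} (hN : 1 ≤ N) {z : ℂ} (hz : 0 < z.im) :
    complexVariance (fun A : SymMat N => normTrace (resolventMat A z)) (goe N) ≤
      32 / (N * z.im ^ 4) := by
  have hm := measurable_normTrace_resolventMat (N := N) z
  have hN' : (0 : ℝ) < N := by exact_mod_cast hN
  rw [complexVariance_eq_add hm fun A => norm_normTrace_resolventMat_le A hz, goe_eq_map hN,
    variance_map (X := fun A : SymMat N => (normTrace (resolventMat A z)).re)
      (Complex.measurable_re.comp hm).aemeasurable (measurable_ofUpper N).aemeasurable,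
    variance_map (X := fun A : SymMat N => (normTrace (resolventMat A z)).im)
      (Complex.measurable_im.comp hm).aemeasurable (measurable_ofUpper N).aemeasurable]
  have h1 := variance_entryLaw_le hN hz
    (f := (fun A : SymMat N => (normTrace (resolventMat A z)).re) ∘ ofUpper)
    ((Complex.measurable_re.comp hm).comp (measurable_ofUpper N))
    (fun x => (Complex.abs_re_le_norm _).trans (norm_normTrace_resolventMat_le (ofUpper x) hz))
    (fun x p s t => by
      rw [Function.comp_apply, Function.comp_apply, ← Complex.sub_re]
      exact (Complex.abs_re_le_norm _).trans (norm_normTrace_resolventMat_sub_le hN hz x p s t))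
  have h2 := variance_entryLaw_le hN hz
    (f := (fun A : SymMat N => (normTrace (resolventMat A z)).im) ∘ ofUpper)
    ((Complex.measurable_im.comp hm).comp (measurable_ofUpper N))
    (fun x => (Complex.abs_im_le_norm _).trans (norm_normTrace_resolventMat_le (ofUpper x) hz))
    (fun x p s t => by
      rw [Function.comp_apply, Function.comp_apply, ← Complex.sub_im]
      exact (Complex.abs_im_le_norm _).trans (norm_normTrace_resolventMat_sub_le hN hz x p s t))
  -- The two parts contribute 8 + 8 = 16, within 32.
  refine (add_le_add h1 h2).trans ?_
  rw [← add_div]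
  gcongr
  norm_num

/-! ### Derivatives of the resolvent and the loop equation. -/

/-- The difference formula is exact, so dividing by t leaves only continuity of the perturbed
resolvent at t = 0, which the same formula and the uniform bound 1/Im z provide. -/
theorem hasLineDerivAt_resolventMat {N : ℕ} {z : ℂ} (hz : 0 < z.im) (x : UpperIdx N → ℝ)
    (p : UpperIdx N) (k l : Fin N) :
    HasLineDerivAt ℝ (fun x => resolventMat (ofUpper x) z k l)
      (-(entryWeight p : ℂ) *
        (resolventMat (ofUpper x) z k p.1.1 * resolventMat (ofUpper x) z p.1.2 l +
          resolventMat (ofUpper x) z k p.1.2 * resolventMat (ofUpper x) z p.1.1 l))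
      x (Pi.single p 1) := by
  set R : ℝ → Matrix (Fin N) (Fin N) ℂ :=
    fun t => resolventMat (ofUpper (x + t • (Pi.single p 1 : UpperIdx N → ℝ))) z with hR
  set Q := resolventMat (ofUpper x) z with hQ
  have hd : ∀ t i j, R t i j - Q i j =
      -(t * entryWeight p : ℂ) * (R t i p.1.1 * Q p.1.2 j + R t i p.1.2 * Q p.1.1 j) :=
    fun t i j => resolventMat_add_smul_single_sub hz x p t i j
  have hc : ∀ i j, Tendsto (fun t => R t i j) (𝓝 0) (𝓝 (Q i j)) := fun i j => by
    refine tendsto_iff_norm_sub_tendsto_zero.2 (squeeze_zero (fun _ => norm_nonneg _) (fun t => ?_)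
      (g := fun t => |t| * (2 / z.im ^ 2)) ?_)
    · rw [hd, norm_mul, norm_neg, norm_mul, Complex.norm_real, Complex.norm_real, Real.norm_eq_abs,
        Real.norm_eq_abs, abs_of_nonneg (entryWeight_nonneg p)]
      have hb : ∀ a b, ‖R t i a * Q b j‖ ≤ 1 / z.im * (1 / z.im) := fun a b => by
        rw [norm_mul]
        exact mul_le_mul (norm_resolventMat_apply_le _ hz _ _) (norm_resolventMat_apply_le _ hz _ _)
          (norm_nonneg _) (by positivity)
      calc _ ≤ |t| * 1 * (1 / z.im * (1 / z.im) + 1 / z.im * (1 / z.im)) := by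
            gcongr
            · exact entryWeight_le_one p
            · exact (norm_add_le _ _).trans (add_le_add (hb _ _) (hb _ _))
        _ = _ := by field_simp; ring
    · have : Continuous fun t : ℝ => |t| * (2 / z.im ^ 2) := by fun_prop
      simpa using this.tendsto 0
  have hR0 : R 0 = Q := by simp [hR, hQ]
  change HasDerivAt (fun t => R t k l) _ 0
  rw [hasDerivAt_iff_tendsto_slope_zero]
  have ht : Tendsto (fun t => -(entryWeight p : ℂ) *
      (R t k p.1.1 * Q p.1.2 l + R t k p.1.2 * Q p.1.1 l)) (𝓝[≠] 0)
      (𝓝 (-(entryWeight p : ℂ) * (Q k p.1.1 * Q p.1.2 l + Q k p.1.2 * Q p.1.1 l))) :=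
    ((((hc _ _).mul_const _).add ((hc _ _).mul_const _)).const_mul _).mono_left nhdsWithin_le_nhds
  refine ht.congr' ?_
  filter_upwards [self_mem_nhdsWithin] with t ht0
  have ht0' : (t : ℂ) ≠ 0 := by exact_mod_cast ht0
  rw [zero_add, hR0, hd, Complex.real_smul]
  push_cast
  field_simp

theorem measurable_resolventMat_ofUpper {N : ℕ} (z : ℂ) (k l : Fin N) :
    Measurable fun x : UpperIdx N → ℝ => resolventMat (ofUpper x) z k l :=
  (measurable_resolventMat_apply z k l).comp (measurable_ofUpper N)

theorem norm_resolventMat_mul_resolventMat_le {N : ℕ} (A : SymMat N) {z : ℂ} (hz : 0 < z.im)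
    (i j k l : Fin N) : ‖resolventMat A z i j * resolventMat A z k l‖ ≤ 1 / z.im ^ 2 := by
  rw [norm_mul]
  calc _ ≤ 1 / z.im * (1 / z.im) := mul_le_mul (norm_resolventMat_apply_le _ hz _ _)
        (norm_resolventMat_apply_le _ hz _ _) (norm_nonneg _) (by positivity)
    _ = _ := by ring

theorem integrable_resolventMat_mul_resolventMat {N : ℕ} {z : ℂ} (hz : 0 < z.im)
    (i j k l : Fin N) : Integrable (fun x : UpperIdx N → ℝ =>
      resolventMat (ofUpper x) z i j * resolventMat (ofUpper x) z k l) (entryLaw N) :=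
  .of_bound ((measurable_resolventMat_ofUpper z i j).mul
    (measurable_resolventMat_ofUpper z k l)).aestronglyMeasurable _
    (ae_of_all _ fun x => norm_resolventMat_mul_resolventMat_le (ofUpper x) hz i j k l)

theorem integral_entry_mul_resolventMat {N : ℕ} (hN : 1 ≤ N) {z : ℂ} (hz : 0 < z.im)
    (i j : Fin N) :
    ∫ x, ((ofUpper x).1 i j : ℂ) * resolventMat (ofUpper x) z j i ∂entryLaw N =
      -(1 / (N : ℂ)) * ∫ x, (resolventMat (ofUpper x) z j i * resolventMat (ofUpper x) z i j +
        resolventMat (ofUpper x) z j j * resolventMat (ofUpper x) z i i) ∂entryLaw N := by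
  set p : UpperIdx N := ⟨(min i j, max i j), min_le_max⟩ with hp
  have hc : ‖-(entryWeight p : ℂ)‖ ≤ 1 := by
    rw [norm_neg, Complex.norm_real, Real.norm_eq_abs, abs_of_nonneg (entryWeight_nonneg p)]
    exact entryWeight_le_one p
  have key := integral_mul_pi_gaussianReal (v := entryVar N) (entryVar_ne_zero hN) p
    (measurable_resolventMat_ofUpper z j i)
    (((((measurable_resolventMat_ofUpper z j p.1.1).mul
      (measurable_resolventMat_ofUpper z p.1.2 i)).add
      ((measurable_resolventMat_ofUpper z j p.1.2).mul
      (measurable_resolventMat_ofUpper z p.1.1 i)))).const_mul (-(entryWeight p : ℂ)))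
    (fun x => norm_resolventMat_apply_le (ofUpper x) hz j i)
    (C' := 1 * (1 / z.im ^ 2 + 1 / z.im ^ 2)) (fun x => by
      rw [norm_mul]
      refine mul_le_mul hc ((norm_add_le _ _).trans (add_le_add
        (norm_resolventMat_mul_resolventMat_le (ofUpper x) hz _ _ _ _)
        (norm_resolventMat_mul_resolventMat_le (ofUpper x) hz _ _ _ _))) (norm_nonneg _)
        zero_le_one)
    (fun x => hasLineDerivAt_resolventMat hz x p j i)
  refine Eq.trans key ?_
  rw [integral_const_mul, ← mul_assoc]
  have hv : (entryVar N p : ℂ) * -(entryWeight p : ℂ) = -(1 / (N : ℂ)) := by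
    have := congrArg Complex.ofReal (entryVar_mul_entryWeight p)
    push_cast at this
    rw [mul_neg, this]
  congr 1
  refine integral_congr_ae (ae_of_all _ fun x => ?_)
  simp only [hp, Pi.add_apply, Pi.mul_apply]
  -- The derivative at the position {i, j} is a sum of two terms that are exchanged when i and j
  -- are, so both orderings agree by symmetry of the resolvent.
  rcases le_total i j with h | h
  · rw [min_eq_left h, max_eq_right h]
    rw [resolventMat_symm _ z i j]
  · rw [min_eq_right h, max_eq_left h, add_comm]
    rw [resolventMat_symm _ z i j]

theorem integrable_entry_mul_resolventMat {N : ℕ} {z : ℂ} (hz : 0 < z.im) (i j : Fin N) :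
    Integrable (fun x : UpperIdx N → ℝ =>
      ((ofUpper x).1 i j : ℂ) * resolventMat (ofUpper x) z j i) (entryLaw N) := by
  refine Integrable.mul_bdd (c := 1 / z.im) ?_
    (measurable_resolventMat_ofUpper z j i).aestronglyMeasurable
    (ae_of_all _ fun x => norm_resolventMat_apply_le (ofUpper x) hz j i)
  refine Integrable.ofReal (integrable_eval (μ := fun p => gaussianReal 0 (entryVar N p))
    (i := ⟨(min i j, max i j), min_le_max⟩) ?_)
  exact (memLp_id_gaussianReal 1).integrable (by norm_num)

theorem sum_entry_mul_resolventMat {N : ℕ} (hN : 1 ≤ N) (A : SymMat N) {z : ℂ} (hz : 0 < z.im) :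
    ∑ i, ∑ j, (A.1 i j : ℂ) * resolventMat A z j i =
      N * (1 + z * normTrace (resolventMat A z)) := by
  have hN' : (N : ℂ) ≠ 0 := by exact_mod_cast (by omega : N ≠ 0)
  have h := shifted_mul_resolventMat A hz
  rw [shifted, sub_mul, smul_mul_assoc, one_mul, sub_eq_iff_eq_add] at h
  have h2 := congrArg Matrix.trace h
  rw [Matrix.trace_add, Matrix.trace_one, Matrix.trace_smul, Fintype.card_fin, smul_eq_mul] at h2
  have h3 : (resolventMat A z).trace = N * normTrace (resolventMat A z) := by
    rw [normTrace]; field_simp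
  rw [h3] at h2
  simp only [Matrix.trace, Matrix.diag, Matrix.mul_apply, Matrix.map_apply] at h2
  rw [h2]
  ring

theorem integrable_normTrace_resolventMat {N : ℕ} {z : ℂ} (hz : 0 < z.im) :
    Integrable (fun A : SymMat N => normTrace (resolventMat A z)) (goe N) :=
  .of_bound (measurable_normTrace_resolventMat z).aestronglyMeasurable _
    (ae_of_all _ fun A => norm_normTrace_resolventMat_le A hz)

theorem integrable_normTrace_resolventMat_sq {N : ℕ} {z : ℂ} (hz : 0 < z.im) :
    Integrable (fun A : SymMat N => normTrace (resolventMat A z) ^ 2) (goe N) :=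
  .of_bound ((measurable_normTrace_resolventMat z).pow_const 2).aestronglyMeasurable
    ((1 / z.im) ^ 2) (ae_of_all _ fun A => by
      rw [norm_pow]
      exact pow_le_pow_left₀ (norm_nonneg _) (norm_normTrace_resolventMat_le A hz) 2)

/-- The loop equation of the Gaussian orthogonal ensemble. -/
theorem loop_equation {N : ℕ} (hN : 1 ≤ N) {z : ℂ} (hz : 0 < z.im) :
    1 + z * ∫ A, normTrace (resolventMat A z) ∂goe N =
      -(∫ A, normTrace (resolventMat A z) ^ 2 ∂goe N) -
        1 / (N : ℂ) * ∫ x, normTrace (resolventMat (ofUpper x) z * resolventMat (ofUpper x) z)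
          ∂entryLaw N := by
  have hN' : (N : ℂ) ≠ 0 := by exact_mod_cast (by omega : N ≠ 0)
  have hm := (measurable_normTrace_resolventMat (N := N) z)
  have hi1 := integrable_normTrace_resolventMat (N := N) hz
  have hi2 := integrable_normTrace_resolventMat_sq (N := N) hz
  rw [goe_eq_map hN] at hi1 hi2 ⊢
  replace hi1 : Integrable (fun x : UpperIdx N → ℝ => normTrace (resolventMat (ofUpper x) z))
      (entryLaw N) := hi1.comp_measurable (measurable_ofUpper N)
  replace hi2 : Integrable (fun x : UpperIdx N → ℝ => normTrace (resolventMat (ofUpper x) z) ^ 2)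
      (entryLaw N) := hi2.comp_measurable (measurable_ofUpper N)
  rw [integral_map (measurable_ofUpper N).aemeasurable hm.aestronglyMeasurable,
    integral_map (measurable_ofUpper N).aemeasurable (hm.pow_const 2).aestronglyMeasurable]
  -- E Tr(AR) is evaluated twice: here from AR = 1 + zR, and in `h2` by Gaussian integration by
  -- parts.
  have h1 : ∫ x, ∑ i, ∑ j, ((ofUpper x).1 i j : ℂ) * resolventMat (ofUpper x) z j i ∂entryLaw N =
      N * (1 + z * ∫ x, normTrace (resolventMat (ofUpper x) z) ∂entryLaw N) := by
    simp_rw [fun x => sum_entry_mul_resolventMat hN (ofUpper x) hz]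
    rw [integral_const_mul, integral_add (integrable_const _) (hi1.const_mul z),
      integral_const_mul]
    simp
  have h2 : ∫ x, ∑ i, ∑ j, ((ofUpper x).1 i j : ℂ) * resolventMat (ofUpper x) z j i ∂entryLaw N =
      -(1 / (N : ℂ)) * ∫ x, ∑ i, ∑ j,
        (resolventMat (ofUpper x) z j i * resolventMat (ofUpper x) z i j +
        resolventMat (ofUpper x) z j j * resolventMat (ofUpper x) z i i) ∂entryLaw N := by
    have hs : ∀ i j, Integrable (fun x : UpperIdx N → ℝ =>
        resolventMat (ofUpper x) z j i * resolventMat (ofUpper x) z i j +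
        resolventMat (ofUpper x) z j j * resolventMat (ofUpper x) z i i) (entryLaw N) := fun i j =>
      (integrable_resolventMat_mul_resolventMat hz j i i j).add
        (integrable_resolventMat_mul_resolventMat hz j j i i)
    rw [integral_finsetSum _ fun i _ => integrable_finsetSum _ fun j _ =>
      integrable_entry_mul_resolventMat hz i j,
      integral_finsetSum _ fun i _ => integrable_finsetSum _ fun j _ => hs i j, Finset.mul_sum]
    refine Finset.sum_congr rfl fun i _ => ?_
    rw [integral_finsetSum _ fun j _ => integrable_entry_mul_resolventMat hz i j,
      integral_finsetSum _ fun j _ => hs i j, Finset.mul_sum]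
    exact Finset.sum_congr rfl fun j _ => integral_entry_mul_resolventMat hN hz i j
  -- The double sum is Tr(R²) + (Tr R)²; after normalisation the first term is smaller by a factor
  -- of order 1/N.
  have h3 : ∀ x : UpperIdx N → ℝ, ∑ i, ∑ j,
        (resolventMat (ofUpper x) z j i * resolventMat (ofUpper x) z i j +
        resolventMat (ofUpper x) z j j * resolventMat (ofUpper x) z i i) =
      N * normTrace (resolventMat (ofUpper x) z * resolventMat (ofUpper x) z) +
        N ^ 2 * normTrace (resolventMat (ofUpper x) z) ^ 2 := fun x => by
    have e : (N : ℂ) ^ 2 * normTrace (resolventMat (ofUpper x) z) ^ 2 =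
        (resolventMat (ofUpper x) z).trace * (resolventMat (ofUpper x) z).trace := by
      rw [normTrace]; field_simp
    have e' : (N : ℂ) * normTrace (resolventMat (ofUpper x) z * resolventMat (ofUpper x) z) =
        (resolventMat (ofUpper x) z * resolventMat (ofUpper x) z).trace := by
      rw [normTrace]; field_simp
    rw [e, e']
    simp only [Matrix.trace, Matrix.diag, Matrix.mul_apply, Finset.sum_mul_sum,
      ← Finset.sum_add_distrib]
    exact Finset.sum_congr rfl fun i _ => Finset.sum_congr rfl fun j _ => by ring
  have hi3 : Integrable (fun x : UpperIdx N → ℝ =>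
      normTrace (resolventMat (ofUpper x) z * resolventMat (ofUpper x) z)) (entryLaw N) := by
    simp only [normTrace, Matrix.trace, Matrix.diag, Matrix.mul_apply]
    exact (integrable_finsetSum _ fun i _ => integrable_finsetSum _ fun j _ =>
      integrable_resolventMat_mul_resolventMat hz i j j i).const_mul _
  simp_rw [h3] at h2
  rw [h1, integral_add (hi3.const_mul _) (hi2.const_mul _), integral_const_mul,
    integral_const_mul] at h2
  refine mul_left_cancel₀ hN' (h2.trans ?_)
  field_simp
  ring

/-! ### Stability of the quadratic equation and convergence in probability. -/

/-- The difference is the integral of (X - EX)² without modulus. This closes the loop equation into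
an approximate equation for the mean alone. -/
theorem norm_integral_sq_sub_sq_le {Ω : Type*} [MeasurableSpace Ω] {P : Measure Ω}
    [IsProbabilityMeasure P] {X : Ω → ℂ} (hX : Integrable X P)
    (hX2 : Integrable (fun ω => X ω ^ 2) P) :
    ‖∫ ω, X ω ^ 2 ∂P - (∫ ω, X ω ∂P) ^ 2‖ ≤ complexVariance X P := by
  set G := ∫ ω, X ω ∂P with hG
  have : ∫ ω, X ω ^ 2 ∂P - G ^ 2 = ∫ ω, (X ω - G) ^ 2 ∂P := by
    have e : ∀ ω, (X ω - G) ^ 2 = X ω ^ 2 - 2 * G * X ω + G ^ 2 := fun ω => by ring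
    simp_rw [e]
    have hs : Integrable (fun ω => X ω ^ 2 - 2 * G * X ω) P := hX2.sub (hX.const_mul _)
    rw [integral_add hs (integrable_const _),
      integral_sub hX2 (hX.const_mul _), integral_const_mul, ← hG]
    simp
    ring
  rw [this]
  refine (norm_integral_le_integral_norm _).trans (le_of_eq ?_)
  simp only [norm_pow, complexVariance, hG]

theorem norm_integral_normTrace_sub_le {N : ℕ} (hN : 1 ≤ N) {z w : ℂ} (hz : 0 < z.im)
    (hw : w ^ 2 + z * w + 1 = 0) (hwi : 0 < w.im) :
    ‖∫ A, normTrace (resolventMat A z) ∂goe N - w‖ ≤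
      (1 / z.im ^ 2 + 32 / z.im ^ 4) / z.im / N := by
  have hN' : (0 : ℝ) < N := by exact_mod_cast hN
  have hi1 := integrable_normTrace_resolventMat (N := N) hz
  have hloop := loop_equation hN hz
  have hvar := (norm_integral_sq_sub_sq_le hi1 (integrable_normTrace_resolventMat_sq hz)).trans
    (complexVariance_normTrace_resolventMat_le hN hz)
  set G := ∫ A, normTrace (resolventMat A z) ∂goe N with hG
  set T := ∫ A, normTrace (resolventMat A z) ^ 2 ∂goe N with hT
  set E := ∫ x, normTrace (resolventMat (ofUpper x) z * resolventMat (ofUpper x) z)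
    ∂entryLaw N with hE
  have hEb : ‖E‖ ≤ 1 / z.im ^ 2 := by
    have := norm_integral_le_of_norm_le_const (μ := entryLaw N)
      (f := fun x => normTrace (resolventMat (ofUpper x) z * resolventMat (ofUpper x) z))
      (C := 1 / z.im ^ 2) (ae_of_all _ fun x => norm_normTrace_le (by positivity) fun i =>
        norm_resolventMat_mul_apply_le (ofUpper x) (ofUpper x) hz i i)
    simpa using this
  have hGi : 0 ≤ G.im := by
    have : G.im = ∫ A, (normTrace (resolventMat A z)).im ∂goe N := (integral_im hi1).symm
    rw [this]
    exact integral_nonneg fun A => im_normTrace_resolventMat_nonneg A hz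
  -- The left side equals G² + zG + 1 because w is a root. The second factor has imaginary part at
  -- least Im z, so it can be divided out.
  have hprod : (G - w) * (G + w + z) = -(1 / (N : ℂ) * E) - (T - G ^ 2) := by
    linear_combination hloop - hw
  have hlow : z.im ≤ ‖G + w + z‖ := by
    refine le_trans ?_ (Complex.abs_im_le_norm _)
    refine le_trans ?_ (le_abs_self _)
    simp only [Complex.add_im]
    linarith
  have hup : ‖G - w‖ * z.im ≤ (1 / z.im ^ 2 + 32 / z.im ^ 4) / N := by
    calc ‖G - w‖ * z.im ≤ ‖G - w‖ * ‖G + w + z‖ := by gcongr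
      _ = ‖-(1 / (N : ℂ) * E) - (T - G ^ 2)‖ := by rw [← norm_mul, hprod]
      _ ≤ 1 / N * (1 / z.im ^ 2) + 32 / (N * z.im ^ 4) := by
          refine (norm_sub_le _ _).trans (add_le_add ?_ hvar)
          rw [norm_neg, norm_mul, norm_div, norm_one, Complex.norm_natCast]
          gcongr
      _ = _ := by field_simp
  rw [div_right_comm]
  exact (le_div_iff₀ hz).2 hup

/-- Chebyshev's inequality around the mean: half of ε absorbs the bias |G - w|, the other half is
left for the fluctuation. -/
theorem goe_norm_sub_ge_le {N : ℕ} (hN : 1 ≤ N) {z w : ℂ} (hz : 0 < z.im) {ε : ℝ} (hε : 0 < ε)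
    (h : ‖∫ A, normTrace (resolventMat A z) ∂goe N - w‖ ≤ ε / 2) :
    goe N {A | ε ≤ ‖normTrace (resolventMat A z) - w‖} ≤
      ENNReal.ofReal (32 / z.im ^ 4 / (ε / 2) ^ 2 / N) := by
  set G := ∫ A, normTrace (resolventMat A z) ∂goe N with hG
  have hm := measurable_normTrace_resolventMat (N := N) z
  have hN' : (0 : ℝ) < N := by exact_mod_cast hN
  have hi : Integrable (fun A : SymMat N => ‖normTrace (resolventMat A z) - G‖ ^ 2) (goe N) := by
    have : MemLp (fun A : SymMat N => normTrace (resolventMat A z) - G) 2 (goe N) :=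
      .of_bound (hm.sub_const _).aestronglyMeasurable (1 / z.im + ‖G‖) (ae_of_all _ fun A =>
        (norm_sub_le _ _).trans (by gcongr; exact norm_normTrace_resolventMat_le A hz))
    exact this.integrable_norm_pow (by norm_num)
  have hmarkov := mul_meas_ge_le_integral_of_nonneg (μ := goe N)
    (ae_of_all _ fun A : SymMat N => sq_nonneg ‖normTrace (resolventMat A z) - G‖) hi ((ε / 2) ^ 2)
  have hvar : ∫ A, ‖normTrace (resolventMat A z) - G‖ ^ 2 ∂goe N ≤ 32 / (N * z.im ^ 4) :=
    complexVariance_normTrace_resolventMat_le hN hz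
  have hsub : {A : SymMat N | ε ≤ ‖normTrace (resolventMat A z) - w‖} ⊆
      {A | (ε / 2) ^ 2 ≤ ‖normTrace (resolventMat A z) - G‖ ^ 2} := fun A hA => by
    simp only [Set.mem_ofPred_eq] at hA ⊢
    refine pow_le_pow_left₀ (by positivity) ?_ 2
    have := norm_sub_le_norm_sub_add_norm_sub (normTrace (resolventMat A z)) G w
    linarith
  refine (measure_mono hsub).trans ?_
  rw [← ofReal_measureReal]
  refine ENNReal.ofReal_le_ofReal ?_
  have h4 := hmarkov.trans hvar
  rw [mul_comm, ← le_div_iff₀ (by positivity)] at h4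
  refine h4.trans (le_of_eq ?_)
  field_simp

end RandomMatrix

theorem mainTheorem6 (z : ℂ) (hz : 0 < z.im) :
    (∀ N : ℕ, 1 ≤ N →
      MemLp (fun A : RandomMatrix.SymMat N =>
        RandomMatrix.normTrace (RandomMatrix.resolventMat A z)) 2 (RandomMatrix.goe N) ∧
      RandomMatrix.complexVariance (fun A : RandomMatrix.SymMat N =>
        RandomMatrix.normTrace (RandomMatrix.resolventMat A z)) (RandomMatrix.goe N) ≤
          32 / ((N : ℝ) * z.im ^ 4)) ∧
    ∀ ε : ℝ, 0 < ε →
      Tendsto (fun N : ℕ => RandomMatrix.goe N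
        {A : RandomMatrix.SymMat N |
          ε ≤ ‖RandomMatrix.stieltjes (RandomMatrix.eigenvalueDistribution A) z -
            RandomMatrix.stieltjes RandomMatrix.semicircle z‖})
        atTop (𝓝 0) := by
  refine ⟨fun N hN => ⟨.of_bound
    (RandomMatrix.measurable_normTrace_resolventMat z).aestronglyMeasurable (1 / z.im)
    (ae_of_all _ fun A => RandomMatrix.norm_normTrace_resolventMat_le A hz),
    RandomMatrix.complexVariance_normTrace_resolventMat_le hN hz⟩, fun ε hε => ?_⟩
  obtain ⟨w, hw, hw1, hwi⟩ := RandomMatrix.exists_root_semicircle hz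
  simp_rw [RandomMatrix.stieltjes_eigenvalueDistribution _ hz,
    RandomMatrix.stieltjes_semicircle hz hw hw1]
  have hlim : ∀ C : ℝ, Tendsto (fun N : ℕ => C / (N : ℝ)) atTop (𝓝 0) :=
    fun C => tendsto_const_div_atTop_nhds_zero_nat C
  refine tendsto_of_tendsto_of_tendsto_of_le_of_le' tendsto_const_nhds
    (h := fun N : ℕ => ENNReal.ofReal (32 / z.im ^ 4 / (ε / 2) ^ 2 / N)) ?_
    (Eventually.of_forall fun _ => zero_le) ?_
  · simpa using ENNReal.tendsto_ofReal (hlim (32 / z.im ^ 4 / (ε / 2) ^ 2))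
  · filter_upwards [eventually_ge_atTop 1, (hlim ((1 / z.im ^ 2 + 32 / z.im ^ 4) / z.im)).eventually
      (gt_mem_nhds (half_pos hε))] with N hN hsmall
    exact RandomMatrix.goe_norm_sub_ge_le hN hz hε
      ((RandomMatrix.norm_integral_normTrace_sub_le hN hz hw hwi).trans hsmall.le)
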